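/- Let $Y_1$ and $Y_2$ be connected 3-manifolds with boundary (topological, Hausdorff and second countable; compactness and orientability are not required), each having boundary homeomorphic to the torus $S^1\times S^1$. Let $\varphi\colon\partial Y_1\to\partial Y_2$ be a homeomorphism (for instance, a diffeomorphism when $Y_1,Y_2$ are smooth), and let $Y=Y_1\cup_\varphi Y_2$ be the space obtained from $Y_1\sqcup Y_2$ by identifying $x$ with $\varphi(x)$ for every $x\in\partial Y_1$. Write $\Sigma\subset Y$ for the torus $\partial Y_1=\partial Y_2$. A representation $\rho\colon G\to SU(2)$ of a group is called abelian if its image is abelian, irreducible if it is not abelian, and central if its image lies in the center $\{\pm1\}$ of $SU(2)$. The manifold $Y$ is called $SU(2)$-abelian if every representation $\pi_1(Y)\to SU(2)$ is abelian. Let $U(1)\subset SU(2)$ be the subgroup of diagonal matrices. For $i\in\{1,2\}$, let $\iota_i\colon\partial Y_i\to Y_i$ be the inclusion and let $A_i$, $H_i$, $P_i$ be the following sets of homomorphisms $\eta\colon\pi_1(\partial Y_i)\to U(1)$: - $\eta\in A_i$ if and only if there is an abelian $\rho\colon\pi_1(Y_i)\to SU(2)$ with $\rho\circ(\iota_i)_*=\eta$;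 - $\eta\in H_i$ if and only if there is an irreducible $\rho\colon\pi_1(Y_i)\to SU(2)$ with $\rho\circ(\iota_i)_*=\eta$; - $\eta\in P_i$ if and only if $\eta$ is central and there is an abelian, non-central $\rho\colon\pi_1(Y_i)\to SU(2)$ with $\rho\circ(\iota_i)_*=\eta$. Here all fundamental groups of $\partial Y_1$ and $Y_1$ are based at an arbitrary point $x\in\partial Y_1$, those of $\partial Y_2$ and $Y_2$ at $\varphi(x)$, and all these sets are regarded as subsets of $\mathrm{Hom}(\pi_1(\Sigma),U(1))$ by identifying $\pi_1(\Sigma)=\pi_1(\partial Y_1)$ with $\pi_1(\partial Y_2)$ through $\varphi_*$. Then $Y$ is $SU(2)$-abelian if and only if the four sets $H_1\cap H_2$, $H_1\cap A_2$, $A_1\cap H_2$ and $P_1\cap P_2$ are all empty. -/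

import Mathlib

open scoped Manifold

namespace SU2Gluing

noncomputable section

/-- The group `SU(2)`. -/
abbrev SU2 : Type := Matrix.specialUnitaryGroup (Fin 2) ℂ

/-- `U(1)`, the subgroup of diagonal matrices in `SU(2)`. -/
def U1 : Subgroup SU2 where
  carrier := {g | (g : Matrix (Fin 2) (Fin 2) ℂ).IsDiag}
  one_mem' := by
    exact (Matrix.isDiag_one : (1 : Matrix (Fin 2) (Fin 2) ℂ).IsDiag)
  mul_mem' := by
    intro a b ha hb i j hij
    simp only [Submonoid.coe_mul, Matrix.mul_apply]
    refine Finset.sum_eq_zero fun k _ => ?_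
    by_cases hik : i = k
    · subst hik
      rw [hb hij, mul_zero]
    · rw [ha hik, zero_mul]
  inv_mem' := by
    intro a ha
    exact Matrix.IsDiag.conjTranspose ha

/-! ### Representations in `SU(2)` -/

section Representations

variable {G : Type*} [Group G]

/-- A representation is abelian if its image is abelian. -/
def IsAbelianRep (ρ : G →* SU2) : Prop :=
  ∀ a b : G, ρ a * ρ b = ρ b * ρ a

/-- A representation is irreducible if it is not abelian. -/
def IsIrreducibleRep (ρ : G →* SU2) : Prop :=
  ¬ IsAbelianRep ρ

/-- A representation is central if its image lies in the center of `SU(2)`. -/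
def IsCentralRep (ρ : G →* SU2) : Prop :=
  ∀ a : G, ρ a ∈ Subgroup.center SU2

end Representations

/-- A group is `SU(2)`-abelian if all its representations in `SU(2)` are abelian. -/
def IsSU2AbelianGroup (G : Type*) [Group G] : Prop :=
  ∀ ρ : G →* SU2, IsAbelianRep ρ

/-- A space is `SU(2)`-abelian if its fundamental group is. (For a path-connected space
all base points give isomorphic groups.) -/
def IsSU2AbelianSpace (X : Type*) [TopologicalSpace X] : Prop :=
  ∀ x : X, IsSU2AbelianGroup (FundamentalGroup X x)

/-! ### Boundaries of 3-manifolds -/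

section Boundary

variable (Y : Type*) [TopologicalSpace Y] [ChartedSpace (EuclideanHalfSpace 3) Y]

/-- The boundary `∂Y` of a 3-manifold `Y`, with the subspace topology. -/
abbrev Bd : Type _ := ((𝓡∂ 3).boundary Y : Set Y)

/-- The inclusion `ι : ∂Y → Y`. -/
def bdIncl : C(Bd Y, Y) := ⟨Subtype.val, continuous_subtype_val⟩

/-- `∂Y` is homeomorphic to the torus `S¹ × S¹`. -/
def HasTorusBoundary : Prop := Nonempty (Bd Y ≃ₜ Circle × Circle)

variable {Y}

/-- `η : π₁(∂Y) → U(1)` is the restriction of `ρ : π₁(Y) → SU(2)`, i.e. `ρ ∘ ι_* = η`. -/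
def Extends (y : Bd Y) (η : FundamentalGroup (Bd Y) y →* U1)
    (ρ : FundamentalGroup Y (bdIncl Y y) →* SU2) : Prop :=
  ρ.comp (FundamentalGroup.map (bdIncl Y) y) = U1.subtype.comp η

/-- `A_Y`: the `U(1)`-representations of `π₁(∂Y)` that extend to abelian ones of `π₁(Y)`. -/
def setA (y : Bd Y) : Set (FundamentalGroup (Bd Y) y →* U1) :=
  {η | ∃ ρ : FundamentalGroup Y (bdIncl Y y) →* SU2, Extends y η ρ ∧ IsAbelianRep ρ}

/-- `H_Y`: the `U(1)`-representations of `π₁(∂Y)` that extend to irreducible ones of `π₁(Y)`. -/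
def setH (y : Bd Y) : Set (FundamentalGroup (Bd Y) y →* U1) :=
  {η | ∃ ρ : FundamentalGroup Y (bdIncl Y y) →* SU2, Extends y η ρ ∧ IsIrreducibleRep ρ}

/-- `P_Y`: the central `U(1)`-representations of `π₁(∂Y)` that extend to abelian non-central
ones of `π₁(Y)`. -/
def setP (y : Bd Y) : Set (FundamentalGroup (Bd Y) y →* U1) :=
  {η | ∃ ρ : FundamentalGroup Y (bdIncl Y y) →* SU2, Extends y η ρ ∧
    IsCentralRep (U1.subtype.comp η) ∧ IsAbelianRep ρ ∧ ¬ IsCentralRep ρ}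

end Boundary

/-! ### Gluing along the boundary -/

section Gluing

variable {Y₁ Y₂ : Type*}
  [TopologicalSpace Y₁] [ChartedSpace (EuclideanHalfSpace 3) Y₁]
  [TopologicalSpace Y₂] [ChartedSpace (EuclideanHalfSpace 3) Y₂]

/-- The relation on `Y₁ ⊔ Y₂` identifying each `x ∈ ∂Y₁` with `φ x ∈ ∂Y₂`. -/
inductive GlueRel (φ : Bd Y₁ ≃ₜ Bd Y₂) : Y₁ ⊕ Y₂ → Y₁ ⊕ Y₂ → Prop
  | glue (x : Bd Y₁) : GlueRel φ (Sum.inl (x : Y₁)) (Sum.inr (φ x : Y₂))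

/-- `Y₁ ∪_φ Y₂`, with the quotient topology: the quotient of `Y₁ ⊔ Y₂` by the equivalence
relation generated by `GlueRel φ`. -/
abbrev Glue (φ : Bd Y₁ ≃ₜ Bd Y₂) : Type _ := Quot (GlueRel φ)

/-- Transport along `φ_* : π₁(∂Y₁) → π₁(∂Y₂)` of a set of `U(1)`-representations of `π₁(∂Y₂)`:
this is how such a set is viewed in `Hom(π₁(Σ), U(1))`, where `Σ = ∂Y₁ = ∂Y₂` in `Y₁ ∪_φ Y₂`. -/
def transport (φ : Bd Y₁ ≃ₜ Bd Y₂) (x : Bd Y₁)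
    (S : Set (FundamentalGroup (Bd Y₂) (φ x) →* U1)) :
    Set (FundamentalGroup (Bd Y₁) x →* U1) :=
  (fun η => η.comp (FundamentalGroup.map (φ : C(Bd Y₁, Bd Y₂)) x)) '' S

end Gluing

end

end SU2Gluing

/-! A representation of the fundamental group of `Glue φ` amounts to a pair of representations of
the two pieces that agree on the torus. This is van Kampen's theorem, proved here in two halves that
need no collar. `exists_pathHom_of_homs` glues a compatible pair. `commute_of_commute_pieces` says
that commutation can be tested on the images of the two pieces; it rests on
`PathHom.toFun_mem_of_glue`. Working with homomorphisms from the fundamental groupoid (`PathHom`)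
lets paths with arbitrary end points be handled before any base point is chosen.

The rest is algebra in `SU2`: every element is conjugate into `U1`, and the centralizer of a
non-central element of `U1` lies in `U1`. If a set H ∩ H, H ∩ A or A ∩ H is nonempty, gluing the two
extensions gives a non-abelian representation. If P ∩ P is nonempty, one extension may be conjugated
without changing its central boundary values, and `SU2.exists_conj_not_commute` makes it fail to
commute with the other.

Conversely, the torus has abelian fundamental group, so after conjugation a representation sends it
into `U1`. Emptiness of the first three sets makes both restrictions abelian. If the boundary values
are not all central, both restrictions lie in `U1`; if they are, emptiness of P ∩ P makes one
restriction central. In either case the two images commute with themselves and with each other. -/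

open scoped unitInterval

namespace SU2Gluing

/-! ### Homomorphisms from the fundamental groupoid to a group -/

/-- A homomorphism from the fundamental groupoid of `X` to the group `G`, with the order of
multiplication of `FundamentalGroup`. -/
structure PathHom (X G : Type*) [TopologicalSpace X] [Group G] where
  /-- The underlying function on paths. -/
  toFun : ∀ {p q : X}, Path p q → G
  map_homotopic : ∀ {p q : X} {γ δ : Path p q}, γ.Homotopic δ → toFun γ = toFun δ
  map_trans : ∀ {p q r : X} (γ : Path p q) (δ : Path q r),
    toFun (γ.trans δ) = toFun δ * toFun γ

namespace PathHom

variable {X Z G : Type*} [TopologicalSpace X] [TopologicalSpace Z] [Group G]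

theorem map_refl (F : PathHom X G) (p : X) : F.toFun (Path.refl p) = 1 := by
  have h := F.map_trans (Path.refl p) (Path.refl p)
  rw [Path.refl_trans_refl] at h
  exact left_eq_mul.mp h

theorem map_symm (F : PathHom X G) {p q : X} (γ : Path p q) :
    F.toFun γ.symm = (F.toFun γ)⁻¹ := by
  rw [eq_inv_iff_mul_eq_one, ← F.map_trans, ← F.map_refl p]
  exact F.map_homotopic ⟨(Path.Homotopy.reflTransSymm γ).symm⟩

theorem congr_of_forall_eq (F : PathHom X G) {p q p' q' : X} (γ : Path p q) (δ : Path p' q')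
    (h : ∀ t, γ t = δ t) : F.toFun γ = F.toFun δ := by
  obtain rfl : p = p' := by rw [← γ.source, ← δ.source, h]
  obtain rfl : q = q' := by rw [← γ.target, ← δ.target, h]
  congr 1
  ext t
  exact h t

/-- Restriction of a `PathHom` along a continuous map. -/
def comap (F : PathHom X G) (f : C(Z, X)) : PathHom Z G where
  toFun γ := F.toFun (γ.map f.continuous)
  map_homotopic h := F.map_homotopic (h.map f)
  map_trans γ δ := by rw [Path.map_trans, F.map_trans]

/-- Change of trivialization of a `PathHom`. -/
def gauge (F : PathHom X G) (g : X → G) : PathHom X G where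
  toFun {p q} γ := (g q)⁻¹ * F.toFun γ * g p
  map_homotopic h := by rw [F.map_homotopic h]
  map_trans γ δ := by rw [F.map_trans]; group

/-- The representation of the fundamental group given by a `PathHom`. -/
def toHom (F : PathHom X G) (x : X) : FundamentalGroup X x →* G where
  toFun := Quotient.lift (fun γ : Path x x => F.toFun γ) (fun _ _ h => F.map_homotopic h)
  map_one' := F.map_refl x
  map_mul' a b := by
    induction a using Path.Homotopic.Quotient.ind
    induction b using Path.Homotopic.Quotient.ind
    exact F.map_trans _ _

/-- The `PathHom` determined by a representation of the fundamental group and a choice of paths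
from the base point. -/
noncomputable def ofHom {x : X} (ρ : FundamentalGroup X x →* G) (τ : ∀ p : X, Path x p) : PathHom X G where
  toFun {p q} γ := ρ (Path.Homotopic.Quotient.mk (((τ p).trans γ).trans (τ q).symm))
  map_homotopic h := by
    congr 1
    exact Path.Homotopic.Quotient.eq.mpr (((Path.Homotopic.refl _).hcomp h).hcomp (.refl _))
  map_trans {p q r} γ δ := by
    rw [← map_mul, FundamentalGroup.mul_def]
    congr 1
    simp only [Path.Homotopic.Quotient.mk_trans, Path.Homotopic.Quotient.mk_symm,
      Path.Homotopic.Quotient.trans_assoc]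
    congr 2
    rw [← Path.Homotopic.Quotient.trans_assoc _ (Path.Homotopic.Quotient.mk (τ q)),
      Path.Homotopic.Quotient.symm_trans, Path.Homotopic.Quotient.refl_trans]

theorem toFun_eq_of_simplyConnected [SimplyConnectedSpace X] (F : PathHom X G) {p q : X}
    (γ δ : Path p q) : F.toFun γ = F.toFun δ :=
  F.map_homotopic (SimplyConnectedSpace.paths_homotopic γ δ)

/-- The two routes from corner to corner of `I × I` are homotopic because the square is simply
connected. This replaces explicit homotopies below. -/
theorem toFun_mul_eq_of_square (F : PathHom X G) (H : C(I × I, X)) {p q r s : X}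
    (a : Path p q) (b : Path q r) (c : Path p s) (d : Path s r)
    (ha : ∀ t, a t = H (0, t)) (hb : ∀ t, b t = H (t, 1))
    (hc : ∀ t, c t = H (t, 0)) (hd : ∀ t, d t = H (1, t)) :
    F.toFun b * F.toFun a = F.toFun d * F.toFun c := by
  have hI : ContractibleSpace I :=
    (convex_Icc (0 : ℝ) 1).contractibleSpace ⟨0, Set.left_mem_Icc.mpr zero_le_one⟩
  have : SimplyConnectedSpace (I × I) := inferInstance
  let a' : Path ((0, 0) : I × I) (0, 1) :=
    ⟨⟨fun t => (0, t), by fun_prop⟩, rfl, rfl⟩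
  let b' : Path ((0, 1) : I × I) (1, 1) :=
    ⟨⟨fun t => (t, 1), by fun_prop⟩, rfl, rfl⟩
  let c' : Path ((0, 0) : I × I) (1, 0) :=
    ⟨⟨fun t => (t, 0), by fun_prop⟩, rfl, rfl⟩
  let d' : Path ((1, 0) : I × I) (1, 1) :=
    ⟨⟨fun t => (1, t), by fun_prop⟩, rfl, rfl⟩
  have key := (F.comap H).toFun_eq_of_simplyConnected (a'.trans b') (c'.trans d')
  rw [map_trans, map_trans] at key
  rw [F.congr_of_forall_eq a (a'.map H.continuous) ha,
    F.congr_of_forall_eq b (b'.map H.continuous) hb,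
    F.congr_of_forall_eq c (c'.map H.continuous) hc,
    F.congr_of_forall_eq d (d'.map H.continuous) hd]
  exact key

theorem toFun_subpath (F : PathHom X G) {p q : X} (γ : Path p q) (r s t : I) :
    F.toFun (γ.subpath r t) = F.toFun (γ.subpath s t) * F.toFun (γ.subpath r s) := by
  rw [← F.map_trans]
  exact F.map_homotopic ⟨(Path.Homotopy.subpathTransSubpath γ r s t).symm⟩

theorem toFun_subpath_zero_one (F : PathHom X G) {p q : X} (γ : Path p q) :
    F.toFun (γ.subpath 0 1) = F.toFun γ :=
  F.congr_of_forall_eq _ _ fun t => by simp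

theorem eventually_range_subpath_subset {p q : X} (γ : Path p q) (t : I) {W : Set X}
    (hW : IsOpen W) (ht : γ t ∈ W) :
    ∀ᶠ s in nhds t, Set.range (γ.subpath t s) ⊆ W := by
  obtain ⟨ε, hε, h⟩ := Metric.isOpen_iff.mp (hW.preimage γ.continuous) t ht
  filter_upwards [Metric.ball_mem_nhds t hε] with s hs
  rw [Path.range_subpath]
  rintro _ ⟨u, hu, rfl⟩
  have hu' : (u : ℝ) ∈ Set.uIcc (t : ℝ) s := by
    rcases Set.mem_uIcc.mp hu with ⟨h₁, h₂⟩ | ⟨h₁, h₂⟩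
    · exact Set.mem_uIcc.mpr (Or.inl ⟨h₁, h₂⟩)
    · exact Set.mem_uIcc.mpr (Or.inr ⟨h₁, h₂⟩)
  refine h (Metric.mem_ball'.mpr (lt_of_le_of_lt ?_ (Metric.mem_ball'.mp hs)))
  exact Real.dist_left_le_of_mem_uIcc hu'

/-- Whether the value on the initial segment up to `t` lies in `H` is locally constant in `t`, and
`I` is connected. This plays the role of subdividing by a Lebesgue number. -/
theorem toFun_mem_of_locally (F : PathHom X G) (H : Subgroup G)
    (hF : ∀ x : X, ∃ W : Set X, IsOpen W ∧ x ∈ W ∧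
      ∀ (p q : X) (γ : Path p q), Set.range γ ⊆ W → F.toFun γ ∈ H)
    {p q : X} (γ : Path p q) : F.toFun γ ∈ H := by
  have hlc : IsLocallyConstant fun t : I => F.toFun (γ.subpath 0 t) ∈ H := by
    rw [IsLocallyConstant.iff_eventually_eq]
    intro t
    obtain ⟨W, hWo, htW, hW⟩ := hF (γ t)
    filter_upwards [eventually_range_subpath_subset γ t hWo htW] with s hs
    rw [F.toFun_subpath γ 0 t s, eq_iff_iff]
    exact H.mul_mem_cancel_left (hW _ _ _ hs)
  have h01 := hlc.apply_eq_of_preconnectedSpace 0 1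
  have h1 := F.toFun_subpath_zero_one γ
  have h0 : F.toFun (γ.subpath 0 0) = 1 := by simpa using F.map_refl (γ 0)
  simp only [h1, h0, H.one_mem, eq_iff_iff, true_iff] at h01
  exact h01

end PathHom

/-! ### Diagonalization and centralizers in `SU2` -/

namespace SU2

open ComplexConjugate

/-- Both sides are the inverse of `g`: one since the determinant is 1, the other by unitarity.
Comparing entries shows that the first row determines the matrix. -/
theorem adjugate_eq_star (g : SU2) : (g : Matrix (Fin 2) (Fin 2) ℂ).adjugate = star g.1 := by
  have hdet := (Matrix.mem_specialUnitaryGroup_iff.mp g.2).2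
  have hmul := Matrix.mem_unitaryGroup_iff.mp (Matrix.mem_specialUnitaryGroup_iff.mp g.2).1
  calc g.1.adjugate = g.1.adjugate * (g.1 * star g.1) := by rw [hmul, mul_one]
    _ = star g.1 := by rw [← mul_assoc, Matrix.adjugate_mul, hdet, one_smul, one_mul]

theorem apply_one_one (g : SU2) : g.1 1 1 = conj (g.1 0 0) := by
  have h := congr_fun (congr_fun (adjugate_eq_star g) 0) 0
  simpa [Matrix.adjugate_fin_two, Matrix.star_apply] using h

theorem apply_one_zero (g : SU2) : g.1 1 0 = -conj (g.1 0 1) := by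
  have h := congr_fun (congr_fun (adjugate_eq_star g) 1) 0
  simp only [Matrix.adjugate_fin_two, Matrix.star_apply] at h
  simpa [neg_eq_iff_eq_neg] using h

theorem mem_U1_iff (g : SU2) : g ∈ U1 ↔ g.1 0 1 = 0 := by
  refine ⟨fun h => h (by decide), fun h i j hij => ?_⟩
  have h' : g.1 1 0 = 0 := by rw [apply_one_zero, h, map_zero, neg_zero]
  fin_cases i <;> fin_cases j <;> simp_all

theorem mem_center_of_apply_eq {g : SU2} (hg : g ∈ U1) (h : g.1 0 0 = g.1 1 1) :
    g ∈ Subgroup.center SU2 := by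
  have h01 := (mem_U1_iff g).mp hg
  have h10 : g.1 1 0 = 0 := by rw [apply_one_zero, h01, map_zero, neg_zero]
  rw [Subgroup.mem_center_iff]
  intro k
  apply Subtype.ext
  ext i j
  fin_cases i <;> fin_cases j <;>
    simp [Matrix.mul_apply, Fin.sum_univ_two, h01, h10, h, mul_comm]

/-- The upper right entry of `g * h - h * g` is `(g₀₀ - g₁₁) * h₀₁`, and a non-central diagonal `g`
has distinct diagonal entries. -/
theorem mem_U1_of_commute {g h : SU2} (hg : g ∈ U1) (hc : g ∉ Subgroup.center SU2)
    (hgh : g * h = h * g) : h ∈ U1 := by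
  have hne : g.1 0 0 ≠ g.1 1 1 := fun he => hc (mem_center_of_apply_eq hg he)
  have h01 := (mem_U1_iff g).mp hg
  have e := congr_arg (fun k : SU2 => k.1 0 1) hgh
  simp only [Submonoid.coe_mul, Matrix.mul_apply, Fin.sum_univ_two, h01, zero_mul, add_zero,
    mul_zero, zero_add] at e
  rw [mem_U1_iff]
  have : (g.1 0 0 - g.1 1 1) * h.1 0 1 = 0 := by rw [sub_mul, e]; ring
  exact (mul_eq_zero.mp this).resolve_left (sub_ne_zero.mpr hne)

theorem commute_of_mem_U1 {g h : SU2} (hg : g ∈ U1) (hh : h ∈ U1) : g * h = h * g := by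
  have g01 := (mem_U1_iff g).mp hg
  have h01 := (mem_U1_iff h).mp hh
  have g10 : g.1 1 0 = 0 := by rw [apply_one_zero, g01, map_zero, neg_zero]
  have h10 : h.1 1 0 = 0 := by rw [apply_one_zero, h01, map_zero, neg_zero]
  apply Subtype.ext
  ext i j
  fin_cases i <;> fin_cases j <;>
    simp [Matrix.mul_apply, Fin.sum_univ_two, h01, h10, g01, g10, mul_comm]

theorem center_le_U1 : Subgroup.center SU2 ≤ U1 := by
  intro g hg
  -- Commuting with one diagonal matrix that has distinct eigenvalues already forces the
  -- off-diagonal entry to vanish.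
  let k : SU2 := ⟨!![Complex.I, 0; 0, -Complex.I], by
    rw [Matrix.mem_specialUnitaryGroup_iff, Matrix.mem_unitaryGroup_iff]
    constructor
    · ext i j
      fin_cases i <;> fin_cases j <;>
        simp [Matrix.mul_apply, Fin.sum_univ_two, Matrix.star_apply]
    · simp [Matrix.det_fin_two]⟩
  have e := congr_arg (fun k : SU2 => k.1 0 1) (Subgroup.mem_center_iff.mp hg k)
  simp only [k, Submonoid.coe_mul, Matrix.mul_apply, Fin.sum_univ_two] at e
  simp at e
  rw [mem_U1_iff]
  have h2 : (2 * Complex.I) * g.1 0 1 = 0 := by linear_combination e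
  exact (mul_eq_zero.mp h2).resolve_left (by simp)

theorem exists_of_normSq_add_eq_one (a b : ℂ) (h : a * conj a + b * conj b = 1) :
    ∃ u : SU2, u.1 0 0 = a ∧ u.1 1 0 = b := by
  refine ⟨⟨!![a, -conj b; b, conj a], ?_⟩, by simp, by simp⟩
  rw [Matrix.mem_specialUnitaryGroup_iff, Matrix.mem_unitaryGroup_iff]
  constructor
  · ext i j
    fin_cases i <;> fin_cases j <;>
      simp [Matrix.mul_apply, Fin.sum_univ_two, Matrix.star_apply] <;> first | ring1 | linear_combination h
  · simp only [Matrix.det_fin_two_of]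
    linear_combination h

theorem exists_eigenvector (M : Matrix (Fin 2) (Fin 2) ℂ) : ∃ (μ : ℂ) (a b : ℂ),
    a * conj a + b * conj b = 1 ∧ M 0 0 * a + M 0 1 * b = μ * a ∧
    M 1 0 * a + M 1 1 * b = μ * b := by
  obtain ⟨μ, hμ⟩ := Module.End.exists_eigenvalue (Matrix.toLin' M)
  obtain ⟨v, hv, hv0⟩ := hμ.exists_hasEigenvector
  rw [Module.End.mem_eigenspace_iff, Matrix.toLin'_apply] at hv
  have h0 := congr_fun hv 0
  have h1 := congr_fun hv 1
  simp only [Matrix.mulVec, dotProduct, Fin.sum_univ_two, Pi.smul_apply, smul_eq_mul] at h0 h1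
  set n : ℝ := Complex.normSq (v 0) + Complex.normSq (v 1) with hn
  have hnpos : 0 < n := by
    have hne : v 0 ≠ 0 ∨ v 1 ≠ 0 := by
      by_contra! hcon
      exact hv0 (by ext i; fin_cases i <;> simp [hcon])
    rcases hne with h | h
    · exact add_pos_of_pos_of_nonneg (Complex.normSq_pos.mpr h) (Complex.normSq_nonneg _)
    · exact add_pos_of_nonneg_of_pos (Complex.normSq_nonneg _) (Complex.normSq_pos.mpr h)
  set c : ℂ := ((Real.sqrt n : ℝ) : ℂ) with hc
  have hcc : c * c = v 0 * conj (v 0) + v 1 * conj (v 1) := by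
    rw [Complex.mul_conj, Complex.mul_conj, hc, ← Complex.ofReal_mul, Real.mul_self_sqrt hnpos.le,
      hn, Complex.ofReal_add]
  have hc0 : c ≠ 0 := by
    rw [hc, Complex.ofReal_ne_zero]
    exact (Real.sqrt_pos.mpr hnpos).ne'
  have hcconj : conj c = c := Complex.conj_ofReal _
  refine ⟨μ, v 0 / c, v 1 / c, ?_, ?_, ?_⟩
  · rw [map_div₀, map_div₀, hcconj]
    field_simp
    linear_combination -hcc
  · field_simp
    linear_combination h0
  · field_simp
    linear_combination h1

/-- Take a unit eigenvector of `g` as first column of `u`. The lower left entry of the conjugate is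
then 0, and in `SU2` this forces the upper right one to be 0 too. -/
theorem exists_conj_mem_U1 (g : SU2) : ∃ u : SU2, u⁻¹ * g * u ∈ U1 := by
  obtain ⟨μ, a, b, hab, h0, h1⟩ := exists_eigenvector g.1
  obtain ⟨u, hu0, hu1⟩ := exists_of_normSq_add_eq_one a b hab
  refine ⟨u, ?_⟩
  have hinv : ((u⁻¹ : SU2) : Matrix (Fin 2) (Fin 2) ℂ) = star u.1 := rfl
  have h10 : (u⁻¹ * g * u).1 1 0 = 0 := by
    simp only [Submonoid.coe_mul, hinv, Matrix.mul_apply, Fin.sum_univ_two, Matrix.star_apply]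
    have u01 : star (u.1 0 1) = -b := by
      rw [← hu1, apply_one_zero, neg_neg]; rfl
    have u11 : star (u.1 1 1) = a := by
      rw [← hu0, apply_one_one]; exact Complex.conj_conj _
    rw [u01, u11, hu0, hu1]
    linear_combination -b * h0 + a * h1
  rw [apply_one_zero, neg_eq_zero] at h10
  rw [mem_U1_iff]
  exact (map_eq_zero _).mp h10

theorem conj_mem_center_iff (u g : SU2) :
    u⁻¹ * g * u ∈ Subgroup.center SU2 ↔ g ∈ Subgroup.center SU2 := by
  constructor
  · intro h
    have h' := (inferInstance : (Subgroup.center SU2).Normal).conj_mem _ h u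
    have e : u * (u⁻¹ * g * u) * u⁻¹ = g := by group
    rwa [e] at h'
  · intro h
    have h' := (inferInstance : (Subgroup.center SU2).Normal).conj_mem _ h u⁻¹
    rwa [inv_inv] at h'

/-- Diagonalizing one non-central element of `S` diagonalizes all of `S`, which lies in its
centralizer. -/
theorem exists_conj_mem_U1_of_commute (S : Set SU2) (hS : ∀ g ∈ S, ∀ h ∈ S, g * h = h * g) :
    ∃ u : SU2, ∀ g ∈ S, u⁻¹ * g * u ∈ U1 := by
  by_cases hc : ∀ g ∈ S, g ∈ Subgroup.center SU2
  · exact ⟨1, fun g hg => by simpa using center_le_U1 (hc g hg)⟩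
  · push Not at hc
    obtain ⟨g, hg, hgc⟩ := hc
    obtain ⟨u, hu⟩ := exists_conj_mem_U1 g
    refine ⟨u, fun h hh => ?_⟩
    refine mem_U1_of_commute hu (fun hcon => hgc ((conj_mem_center_iff u g).mp hcon)) ?_
    calc u⁻¹ * g * u * (u⁻¹ * h * u) = u⁻¹ * (g * h) * u := by group
      _ = u⁻¹ * (h * g) * u := by rw [hS g hg h hh]
      _ = _ := by group

theorem exists_conj_not_mem_U1 {g : SU2} (hg : g ∉ Subgroup.center SU2) :
    ∃ u : SU2, u⁻¹ * g * u ∉ U1 := by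
  by_cases hgU : g ∈ U1
  · have hne : g.1 0 0 ≠ g.1 1 1 := fun he => hg (mem_center_of_apply_eq hgU he)
    -- Any rotation mixing the two axes would do; the rational one gives lower left entry `(12 / 25)
    -- * (g₁₁ - g₀₀)`.
    obtain ⟨u, hu0, hu1⟩ := exists_of_normSq_add_eq_one (3 / 5) (4 / 5) (by
      simp only [map_div₀, Complex.conj_ofNat]; norm_num)
    refine ⟨u, fun hmem => ?_⟩
    have h10 : (u⁻¹ * g * u).1 1 0 = 0 := hmem (by decide)
    have hinv : ((u⁻¹ : SU2) : Matrix (Fin 2) (Fin 2) ℂ) = star u.1 := rfl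
    simp only [Submonoid.coe_mul, hinv, Matrix.mul_apply, Fin.sum_univ_two,
      Matrix.star_apply] at h10
    have u01 : star (u.1 0 1) = -(4 / 5) := by
      rw [← hu1, apply_one_zero, neg_neg]; rfl
    have u11 : star (u.1 1 1) = 3 / 5 := by
      rw [← hu0, apply_one_one]; exact Complex.conj_conj _
    have g01 : g.1 0 1 = 0 := hgU (by decide)
    have g10 : g.1 1 0 = 0 := hgU (by decide)
    rw [u01, u11, hu0, hu1, g01, g10] at h10
    exact hne (by linear_combination (-25 / 12 : ℂ) * h10)
  · exact ⟨1, by simpa using hgU⟩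

theorem exists_conj_not_commute {g h : SU2} (hg : g ∉ Subgroup.center SU2)
    (hh : h ∉ Subgroup.center SU2) : ∃ u : SU2, g * (u⁻¹ * h * u) ≠ (u⁻¹ * h * u) * g := by
  obtain ⟨v, hv⟩ := exists_conj_mem_U1 g
  obtain ⟨w, hw⟩ := exists_conj_not_mem_U1 hh
  -- In the eigenbasis of `g` given by `v`, the conjugate of `h` becomes `w⁻¹ * h * w`, which is not
  -- diagonal.
  refine ⟨w * v⁻¹, fun hcomm => hw ?_⟩
  refine mem_U1_of_commute hv (fun hcon => hg ((conj_mem_center_iff v g).mp hcon)) ?_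
  have e : (w * v⁻¹)⁻¹ * h * (w * v⁻¹) = v * (w⁻¹ * h * w) * v⁻¹ := by group
  rw [e] at hcomm
  calc v⁻¹ * g * v * (w⁻¹ * h * w) = v⁻¹ * (g * (v * (w⁻¹ * h * w) * v⁻¹)) * v := by group
    _ = v⁻¹ * (v * (w⁻¹ * h * w) * v⁻¹ * g) * v := by rw [hcomm]
    _ = _ := by group

end SU2

/-! ### Small neighbourhoods with canonical connecting paths -/

/-- `c` connects the points of `V` to each other by paths in `V` which depend continuously on
their end points and are constant on the diagonal. -/
structure IsEquiconnecting {X : Type*} [TopologicalSpace X] (V : Set X) (c : X → X → I → X) :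
    Prop where
  continuousOn : ContinuousOn (fun z : X × X × I => c z.1 z.2.1 z.2.2) (V ×ˢ V ×ˢ Set.univ)
  mapsTo : ∀ p ∈ V, ∀ q ∈ V, ∀ t, c p q t ∈ V
  zero : ∀ p ∈ V, ∀ q ∈ V, c p q 0 = p
  one : ∀ p ∈ V, ∀ q ∈ V, c p q 1 = q
  diag : ∀ p ∈ V, ∀ t, c p p t = p

namespace IsEquiconnecting

variable {X G : Type*} [TopologicalSpace X] [Group G] {V : Set X} {c : X → X → I → X}

theorem continuous_comp (h : IsEquiconnecting V c) {Z : Type*} [TopologicalSpace Z]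
    {f g : Z → X} {s : Z → I} (hf : Continuous f) (hg : Continuous g) (hs : Continuous s)
    (hfV : ∀ z, f z ∈ V) (hgV : ∀ z, g z ∈ V) : Continuous fun z => c (f z) (g z) (s z) :=
  h.continuousOn.comp_continuous (f := fun z => (f z, g z, s z)) (by fun_prop)
    fun z => ⟨hfV z, hgV z, Set.mem_univ _⟩

theorem exists_path (h : IsEquiconnecting V c) {p q : X} (hp : p ∈ V) (hq : q ∈ V) :
    ∃ γ : Path p q, Set.range γ ⊆ V :=
  ⟨⟨⟨fun t => c p q t, h.continuous_comp continuous_const continuous_const continuous_id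
    (fun _ => hp) fun _ => hq⟩, h.zero p hp q hq, h.one p hp q hq⟩, by
    rintro _ ⟨t, rfl⟩
    exact h.mapsTo p hp q hq t⟩

/-- Sliding `γ t` to `δ t` along `c` is a homotopy; it fixes the end points because `c` is constant
on the diagonal. -/
theorem toFun_eq (h : IsEquiconnecting V c) (F : PathHom X G) {p q : X} (γ δ : Path p q)
    (hγ : Set.range γ ⊆ V) (hδ : Set.range δ ⊆ V) : F.toFun γ = F.toFun δ := by
  have hγ' : ∀ t, γ t ∈ V := fun t => hγ ⟨t, rfl⟩
  have hδ' : ∀ t, δ t ∈ V := fun t => hδ ⟨t, rfl⟩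
  have hp : p ∈ V := γ.source ▸ hγ' 0
  have hq : q ∈ V := γ.target ▸ hγ' 1
  let H : C(I × I, X) := ⟨fun z => c (γ z.2) (δ z.2) z.1,
    h.continuous_comp (by fun_prop) (by fun_prop) (by fun_prop) (fun z => hγ' z.2)
      fun z => hδ' z.2⟩
  have key := F.toFun_mul_eq_of_square H γ (Path.refl q) (Path.refl p) δ
    (fun t => (h.zero _ (hγ' t) _ (hδ' t)).symm)
    (fun t => by simp [H, h.diag q hq])
    (fun t => by simp [H, h.diag p hp])
    (fun t => (h.one _ (hγ' t) _ (hδ' t)).symm)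
  simpa [F.map_refl] using key

theorem pullback (h : IsEquiconnecting V c) {Y : Type*} [TopologicalSpace Y]
    (e : OpenPartialHomeomorph Y X) (hV : V ⊆ e.target) :
    IsEquiconnecting (e.source ∩ e ⁻¹' V) fun a b t => e.symm (c (e a) (e b) t) where
  continuousOn := by
    have hcont : ContinuousOn (fun z : Y × Y × I => (e z.1, e z.2.1, z.2.2))
        ((e.source ∩ e ⁻¹' V) ×ˢ (e.source ∩ e ⁻¹' V) ×ˢ Set.univ) := by
      refine ContinuousOn.prodMk ?_ (ContinuousOn.prodMk ?_ ?_)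
      · exact e.continuousOn.comp continuousOn_fst fun z hz => hz.1.1
      · exact e.continuousOn.comp (continuous_fst.comp continuous_snd).continuousOn
          fun z hz => hz.2.1.1
      · exact (continuous_snd.comp continuous_snd).continuousOn
    refine e.continuousOn_symm.comp
      (h.continuousOn.comp hcont fun z hz => ⟨hz.1.2, hz.2.1.2, Set.mem_univ _⟩) ?_
    exact fun z hz => hV (h.mapsTo _ hz.1.2 _ hz.2.1.2 _)
  mapsTo a ha b hb t := by
    have hc := h.mapsTo _ ha.2 _ hb.2 t
    refine ⟨e.map_target (hV hc), ?_⟩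
    rwa [Set.mem_preimage, e.right_inv (hV hc)]
  zero a ha b hb := by rw [h.zero _ ha.2 _ hb.2, e.left_inv ha.1]
  one a ha b hb := by rw [h.one _ ha.2 _ hb.2, e.left_inv hb.1]
  diag a ha t := by rw [h.diag _ ha.2, e.left_inv ha.1]

end IsEquiconnecting

/-- Affine segments in the half space. -/
noncomputable def halfSpaceSegment (p q : EuclideanHalfSpace 3) (t : I) : EuclideanHalfSpace 3 :=
  ⟨(1 - (t : ℝ)) • p.1 + (t : ℝ) • q.1, by
    have h1 : 0 ≤ (1 - (t : ℝ)) * p.1 0 := mul_nonneg (sub_nonneg.mpr t.2.2) p.2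
    have h2 : 0 ≤ (t : ℝ) * q.1 0 := mul_nonneg t.2.1 q.2
    simpa using add_nonneg h1 h2⟩

theorem continuous_halfSpaceSegment :
    Continuous fun z : EuclideanHalfSpace 3 × EuclideanHalfSpace 3 × I =>
      halfSpaceSegment z.1 z.2.1 z.2.2 := by
  refine Continuous.subtype_mk ?_ _
  have h1 : Continuous fun z : EuclideanHalfSpace 3 × EuclideanHalfSpace 3 × I => z.1.1 :=
    continuous_subtype_val.comp continuous_fst
  have h2 : Continuous fun z : EuclideanHalfSpace 3 × EuclideanHalfSpace 3 × I => z.2.1.1 :=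
    continuous_subtype_val.comp (continuous_fst.comp continuous_snd)
  have h3 : Continuous fun z : EuclideanHalfSpace 3 × EuclideanHalfSpace 3 × I => (z.2.2 : ℝ) :=
    continuous_subtype_val.comp (continuous_snd.comp continuous_snd)
  exact ((continuous_const.sub h3).smul h1).add (h3.smul h2)

theorem isEquiconnecting_halfSpaceSegment {B : Set (EuclideanSpace ℝ (Fin 3))}
    (hB : Convex ℝ B) :
    IsEquiconnecting (Subtype.val ⁻¹' B : Set (EuclideanHalfSpace 3)) halfSpaceSegment where
  continuousOn := continuous_halfSpaceSegment.continuousOn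
  mapsTo _ hp _ hq t := hB hp hq (sub_nonneg.mpr t.2.2) t.2.1 (by ring)
  zero _ _ _ _ := Subtype.ext (by simp [halfSpaceSegment])
  one _ _ _ _ := Subtype.ext (by simp [halfSpaceSegment])
  diag _ _ _ := Subtype.ext (by simp [halfSpaceSegment, ← add_smul])

/-- A ball meets the half space in a convex set, at boundary points as well; pull its segments back
by a chart. -/
theorem exists_equiconnecting {Y : Type*} [TopologicalSpace Y]
    [ChartedSpace (EuclideanHalfSpace 3) Y] (p : Y) {N : Set Y} (hN : IsOpen N) (hp : p ∈ N) :
    ∃ (V : Set Y) (c : Y → Y → I → Y), IsOpen V ∧ p ∈ V ∧ V ⊆ N ∧ IsEquiconnecting V c := by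
  let e := chartAt (EuclideanHalfSpace 3) p
  have hpe : p ∈ e.source := mem_chart_source _ p
  have hO : IsOpen (e.target ∩ e.symm ⁻¹' N) := e.isOpen_inter_preimage_symm hN
  obtain ⟨O, hOo, hO'⟩ := isOpen_induced_iff.mp hO
  have hpO : (e p).1 ∈ O := by
    have : e p ∈ Subtype.val ⁻¹' O := by
      rw [hO']
      exact ⟨e.map_source hpe, by simpa [e.left_inv hpe] using hp⟩
    exact this
  obtain ⟨r, hr, hball⟩ := Metric.isOpen_iff.mp hOo _ hpO
  have hsub : (Subtype.val ⁻¹' Metric.ball (e p).1 r : Set (EuclideanHalfSpace 3)) ⊆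
      e.target ∩ e.symm ⁻¹' N := by
    rw [← hO']
    exact Set.preimage_mono hball
  refine ⟨_, _, e.isOpen_inter_preimage (Metric.isOpen_ball.preimage continuous_subtype_val),
    ⟨hpe, Metric.mem_ball_self hr⟩, fun a ha => ?_,
    (isEquiconnecting_halfSpaceSegment (convex_ball _ _)).pullback e fun z hz => (hsub hz).1⟩
  have h := (hsub ha.2).2
  rwa [Set.mem_preimage, e.left_inv ha.1] at h

/-! ### The boundary torus: neighbourhood retraction and commuting loops -/

theorem exists_projection_circle :
    ∃ ν : ℂ → Circle, ContinuousOn ν {z | z ≠ 0} ∧ ∀ z : Circle, ν z = z := by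
  have hmem : ∀ z : ℂ, z ≠ 0 → z / (‖z‖ : ℂ) ∈ Submonoid.unitSphere ℂ := fun z hz => by
    simp [Submonoid.unitSphere, hz]
  let ν : {z : ℂ // z ≠ 0} → Circle := fun z => ⟨z.1 / (‖z.1‖ : ℂ), hmem z.1 z.2⟩
  have hν : Continuous ν := by
    refine Continuous.subtype_mk ?_ _
    exact continuous_subtype_val.div
      (Complex.continuous_ofReal.comp (continuous_norm.comp continuous_subtype_val))
      fun z => by simpa using z.2
  classical
  refine ⟨fun z => if h : z ≠ 0 then ν ⟨z, h⟩ else 1, ?_, fun z => ?_⟩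
  · rw [continuousOn_iff_continuous_domRestrict]
    refine hν.congr fun z => ?_
    have hz : (z : ℂ) ≠ 0 := z.2
    simp only [Set.domRestrict_apply, dif_pos hz]
  · have hz : (z : ℂ) ≠ 0 := z.coe_ne_zero
    refine (dif_pos hz).trans (Circle.ext ?_)
    change (z : ℂ) / (‖(z : ℂ)‖ : ℂ) = z
    rw [z.norm_coe, Complex.ofReal_one, div_one]

/-- Embed the torus in `ℂ × ℂ`, extend the coordinates to `Y` by Tietze, and project radially where
neither vanishes. This retraction does the work of a collar. -/
theorem exists_retraction_of_homeomorph_torus {Y : Type*} [TopologicalSpace Y] [NormalSpace Y]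
    {S : Set Y} (hS : IsClosed S) (h : S ≃ₜ Circle × Circle) :
    ∃ (N : Set Y) (r : Y → S), IsOpen N ∧ S ⊆ N ∧ ContinuousOn r N ∧ ∀ s : S, r s = s := by
  obtain ⟨ν, hν, hνz⟩ := exists_projection_circle
  let f : C(S, ℂ × ℂ) := ⟨fun s => (((h s).1 : ℂ), ((h s).2 : ℂ)), by fun_prop⟩
  obtain ⟨g, hg⟩ := ContinuousMap.exists_restrict_eq hS f
  have hg' : ∀ s : S, g s = (((h s).1 : ℂ), ((h s).2 : ℂ)) := fun s => DFunLike.congr_fun hg s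
  refine ⟨{y | (g y).1 ≠ 0 ∧ (g y).2 ≠ 0},
    fun y => h.symm (ν (g y).1, ν (g y).2), ?_, ?_, ?_, ?_⟩
  · exact (isOpen_ne.preimage (continuous_fst.comp g.continuous)).inter
      (isOpen_ne.preimage (continuous_snd.comp g.continuous))
  · intro s hs
    simp [hg' ⟨s, hs⟩]
  · refine h.symm.continuous.comp_continuousOn (ContinuousOn.prodMk ?_ ?_)
    · exact hν.comp (continuous_fst.comp g.continuous).continuousOn
        fun y hy => hy.1
    · exact hν.comp (continuous_snd.comp g.continuous).continuousOn
        fun y hy => hy.2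
  · intro s
    simp [hg' s, hνz]

theorem normalSpace_of_chartedSpace (Y : Type*) [TopologicalSpace Y] [T2Space Y]
    [SecondCountableTopology Y] [ChartedSpace (EuclideanHalfSpace 3) Y] : NormalSpace Y := by
  have : LocallyCompactSpace (EuclideanHalfSpace 3) := by
    have hc : IsClosed {x : EuclideanSpace ℝ (Fin 3) | 0 ≤ x 0} :=
      isClosed_le continuous_const (by fun_prop)
    exact hc.isClosedEmbedding_subtypeVal.locallyCompactSpace
  have := ChartedSpace.locallyCompactSpace (EuclideanHalfSpace 3) Y
  infer_instance

theorem pathConnectedSpace_of_chartedSpace (Y : Type*) [TopologicalSpace Y] [ConnectedSpace Y]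
    [ChartedSpace (EuclideanHalfSpace 3) Y] : PathConnectedSpace Y := by
  have := ChartedSpace.locallyPathConnectedSpace (EuclideanHalfSpace 3) Y
  exact pathConnectedSpace_iff_connectedSpace.mpr inferInstance

theorem locallyPathConnectedSpace_circle : LocallyPathConnectedSpace Circle :=
  ChartedSpace.locallyPathConnectedSpace (EuclideanSpace ℝ (Fin 1)) Circle

section HasTorusBoundary

variable {Y : Type*} [TopologicalSpace Y] [ChartedSpace (EuclideanHalfSpace 3) Y]

theorem HasTorusBoundary.isClosed [T2Space Y] (h : HasTorusBoundary Y) :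
    IsClosed ((𝓡∂ 3).boundary Y) := by
  obtain ⟨h⟩ := h
  have : CompactSpace (Bd Y) := h.symm.compactSpace
  exact (isCompact_iff_compactSpace.mpr this).isClosed

theorem HasTorusBoundary.pathConnectedSpace (h : HasTorusBoundary Y) :
    PathConnectedSpace (Bd Y) := by
  obtain ⟨h⟩ := h
  exact h.symm.surjective.pathConnectedSpace h.symm.continuous

theorem HasTorusBoundary.locallyPathConnectedSpace (h : HasTorusBoundary Y) :
    LocallyPathConnectedSpace (Bd Y) := by
  obtain ⟨h⟩ := h
  have := locallyPathConnectedSpace_circle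
  exact h.isOpenEmbedding.locallyPathConnectedSpace

theorem HasTorusBoundary.exists_retraction [T2Space Y] [SecondCountableTopology Y]
    (h : HasTorusBoundary Y) :
    ∃ (N : Set Y) (r : Y → Bd Y), IsOpen N ∧ (∀ s : Bd Y, (s : Y) ∈ N) ∧ ContinuousOn r N ∧
      ∀ s : Bd Y, r s = s := by
  have := normalSpace_of_chartedSpace Y
  obtain ⟨N, r, hN, hS, hr, hrs⟩ := exists_retraction_of_homeomorph_torus h.isClosed h.some
  exact ⟨N, r, hN, fun s => hS s.2, hr, hrs⟩

theorem HasTorusBoundary.toFun_mul_comm {G : Type*} [Group G] (h : HasTorusBoundary Y)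
    (F : PathHom (Bd Y) G) {x : Bd Y} (γ δ : Path x x) :
    F.toFun γ * F.toFun δ = F.toFun δ * F.toFun γ := by
  obtain ⟨h⟩ := h
  -- The group structure of the torus spans a square whose sides are `γ` and `δ`; the factor `(h
  -- x)⁻¹` normalizes the base point.
  let H : C(I × I, Bd Y) := ⟨fun z => h.symm (h (γ z.1) * (h x)⁻¹ * h (δ z.2)), by fun_prop⟩
  exact F.toFun_mul_eq_of_square H δ γ γ δ (fun t => by simp [H]) (fun t => by simp [H])
    (fun t => by simp [H]) (fun t => by simp [H])

end HasTorusBoundary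

/-! ### Holonomy of a local system -/

section LocalSystem

variable {X G : Type*} [Group G]

/-- `s` is a flat section along `γ` of the local system on `X` which is trivialized around each
point `z` by the function `f z`. -/
def IsFlatSection (f : X → X → G) (γ : I → X) (s : I → G) : Prop :=
  ∀ t₀, ∀ᶠ t in nhds t₀, (f (γ t₀) (γ t))⁻¹ * s t = s t₀

theorem IsFlatSection.comp {f : X → X → G} {γ : I → X} {s : I → G} (h : IsFlatSection f γ s)
    {u : I → I} (hu : Continuous u) : IsFlatSection f (γ ∘ u) (s ∘ u) :=
  fun t₀ => (hu.tendsto t₀).eventually (h (u t₀))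

theorem IsFlatSection.mul_right {f : X → X → G} {γ : I → X} {s : I → G}
    (h : IsFlatSection f γ s) (g : G) : IsFlatSection f γ fun t => s t * g :=
  fun t₀ => (h t₀).mono fun t ht => by rw [← mul_assoc, ht]

/-- With `G` discrete, the locally constant transition functions `f j⁻¹ * f i` define a covering of
`X` with fibre `G`. The holonomy is the end point of the lift that starts at 1, and homotopy lifting
makes it invariant. -/
theorem exists_pathHom_of_localSystem [TopologicalSpace X] (W : X → Set X) (f : X → X → G)
    (hWo : ∀ z, IsOpen (W z)) (hW : ∀ z, z ∈ W z) (hf : ∀ z, f z z = 1)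
    (hloc : ∀ i j, ∀ z ∈ W i ∩ W j, ∀ᶠ w in nhds z, (f j w)⁻¹ * f i w = (f j z)⁻¹ * f i z) :
    ∃ F : PathHom X G, ∀ (p q : X) (γ : Path p q) (s : I → G), IsFlatSection f γ s →
      F.toFun γ * s 0 = s 1 := by
  let _ : TopologicalSpace G := ⊥
  have : DiscreteTopology G := ⟨rfl⟩
  let Z : FiberBundleCore X X G :=
    { baseSet := W
      isOpen_baseSet := hWo
      indexAt := id
      mem_baseSet_at := hW
      coordChange := fun i j z v => (f j z)⁻¹ * f i z * v
      coordChange_self := fun i z _ v => by simp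
      continuousOn_coordChange := fun i j => by
        rintro ⟨z, v⟩ ⟨hz, -⟩
        refine ContinuousAt.continuousWithinAt ?_
        have hc : ContinuousAt (fun p : X × G => (f j z)⁻¹ * f i z * p.2) (z, v) :=
          (continuous_of_discreteTopology.comp continuous_snd).continuousAt
        refine hc.congr ?_
        filter_upwards [(continuous_fst.tendsto (z, v)).eventually (hloc i j z hz)] with p hp
        rw [hp]
      coordChange_comp := fun i j k z _ v => by group }
  have cov : IsCoveringMap Z.proj := FiberBundle.isCoveringMap (F := G) (E := Z.Fiber)
  let mkE : X → G → Z.TotalSpace := fun z v => ⟨z, v⟩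
  let coord : Z.TotalSpace → G := fun e => e.2
  -- Since the fibre is discrete, continuity of a lift means that its coordinate is eventually
  -- constant in the trivialization at each time, which is flatness.
  have hcont : ∀ Γ : I → Z.TotalSpace, Continuous Γ ↔
      Continuous (Z.proj ∘ Γ) ∧ IsFlatSection f (Z.proj ∘ Γ) (coord ∘ Γ) := by
    intro Γ
    have hval : ∀ t₀ t, (trivializationAt G Z.Fiber (Γ t₀).proj (Γ t)).2 =
        (f (Z.proj (Γ t₀)) (Z.proj (Γ t)))⁻¹ * f (Z.proj (Γ t)) (Z.proj (Γ t)) * coord (Γ t) :=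
      fun _ _ => rfl
    simp only [continuous_iff_continuousAt, FiberBundle.continuousAt_totalSpace, hval, hf, mul_one,
      forall_and]
    refine and_congr Iff.rfl (forall_congr' fun t₀ => ?_)
    rw [ContinuousAt, nhds_discrete G, Filter.tendsto_pure, hf, inv_one, one_mul]
    rfl
  let Γ : ∀ {p q : X}, Path p q → C(I, Z.TotalSpace) := fun {p q} γ =>
    cov.liftPath γ (mkE p 1) γ.source
  have hΓ0 : ∀ {p q : X} (γ : Path p q), Γ γ 0 = mkE p 1 := fun γ => cov.liftPath_zero _ _ _
  have hΓp : ∀ {p q : X} (γ : Path p q), Z.proj ∘ Γ γ = γ := fun γ => cov.liftPath_lifts _ _ _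
  let hol : ∀ {p q : X}, Path p q → G := fun γ => coord (Γ γ 1)
  have hsec : ∀ {p q : X} (γ : Path p q), IsFlatSection f γ (coord ∘ Γ γ) := fun γ => by
    have h := ((hcont (Γ γ)).mp (Γ γ).continuous).2
    rwa [hΓp] at h
  have huniq : ∀ {p q : X} (γ : Path p q) (s : I → G), IsFlatSection f γ s →
      hol γ * s 0 = s 1 := by
    intro p q γ s hs
    -- Right translation preserves flatness, so `s` can be normalized to start at 1; uniqueness of
    -- lifts applies.
    have hΓ' : (fun t => mkE (γ t) (s t * (s 0)⁻¹)) = Γ γ := by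
      refine (cov.eq_liftPath_iff _).mpr ⟨(hcont _).mpr ⟨γ.continuous, ?_⟩, rfl, ?_⟩
      · exact hs.mul_right _
      · simp only [γ.source, mul_inv_cancel]
    have h1 : s 1 * (s 0)⁻¹ = hol γ := congr_arg coord (congr_fun hΓ' 1)
    rw [← h1, inv_mul_cancel_right]
  refine ⟨⟨hol, ?_, ?_⟩, fun p q γ s hs => huniq γ s hs⟩
  · intro p q γ δ h
    exact congr_arg coord (cov.liftPath_apply_one_eq_of_homotopicRel h _ _ _)
  · intro p q r γ δ
    have h := hsec (γ.trans δ)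
    set s := coord ∘ Γ (γ.trans δ) with hs
    let u : I → I := fun t => ⟨(t : ℝ) / 2, by have := t.2.1; have := t.2.2; constructor <;> linarith⟩
    let v : I → I := fun t => ⟨((t : ℝ) + 1) / 2,
      by have := t.2.1; have := t.2.2; constructor <;> linarith⟩
    have hu : Continuous u := by fun_prop
    have hv : Continuous v := by fun_prop
    have hγ : (γ.trans δ) ∘ u = γ := by
      ext t
      have ht : ((u t : I) : ℝ) ≤ 1 / 2 := by have := t.2.2; simp only [u]; linarith
      simp only [Function.comp_apply, Path.trans_apply, dif_pos ht]
      congr 1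
      exact Subtype.ext (by simp only [u]; ring)
    have hδ : (γ.trans δ) ∘ v = δ := by
      ext t
      by_cases ht : ((v t : I) : ℝ) ≤ 1 / 2
      · have ht0 : t = 0 := by
          have := t.2.1
          simp only [v] at ht
          exact Subtype.ext (by simp only [Set.Icc.coe_zero]; linarith)
        subst ht0
        simp only [Function.comp_apply, Path.trans_apply, dif_pos ht, δ.source]
        convert γ.target
        simp [v]
      · simp only [Function.comp_apply, Path.trans_apply, dif_neg ht]
        congr 1
        exact Subtype.ext (by simp only [v]; ring)
    have h1 := huniq γ (s ∘ u) (hγ ▸ h.comp hu)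
    have h2 := huniq δ (s ∘ v) (hδ ▸ h.comp hv)
    have h0 : s 0 = 1 := congr_arg coord (hΓ0 (γ.trans δ))
    have e0 : u 0 = 0 := Subtype.ext (by simp [u])
    have e1 : u 1 = v 0 := Subtype.ext (by simp [u, v])
    have e2 : v 1 = 1 := Subtype.ext (by simp [v])
    simp only [Function.comp_apply, e0, e1, e2, h0, mul_one] at h1 h2
    rw [h1, h2]
    rfl

end LocalSystem

/-! ### Topology of the glued space -/

section Glue

variable {Y₁ Y₂ : Type*}
  [TopologicalSpace Y₁] [ChartedSpace (EuclideanHalfSpace 3) Y₁]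
  [TopologicalSpace Y₂] [ChartedSpace (EuclideanHalfSpace 3) Y₂]

namespace Glue

/-- The map of `Y₁` to `Y₁ ∪_φ Y₂`. -/
def inl (φ : Bd Y₁ ≃ₜ Bd Y₂) : C(Y₁, Glue φ) :=
  ⟨fun p => Quot.mk _ (Sum.inl p), continuous_quot_mk.comp continuous_inl⟩

/-- The map of `Y₂` to `Y₁ ∪_φ Y₂`. -/
def inr (φ : Bd Y₁ ≃ₜ Bd Y₂) : C(Y₂, Glue φ) :=
  ⟨fun q => Quot.mk _ (Sum.inr q), continuous_quot_mk.comp continuous_inr⟩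

variable (φ : Bd Y₁ ≃ₜ Bd Y₂)

theorem inl_boundary (b : Bd Y₁) : inl φ b = inr φ (φ b) :=
  Quot.sound (GlueRel.glue b)

variable {φ}

theorem exists_inl_or_inr (z : Glue φ) : (∃ p, inl φ p = z) ∨ ∃ q, inr φ q = z := by
  induction z using Quot.ind with
  | mk z =>
    rcases z with p | q
    · exact Or.inl ⟨p, rfl⟩
    · exact Or.inr ⟨q, rfl⟩

theorem inl_injective : Function.Injective (inl φ) := by
  intro p p' h
  -- A predicate compatible with the gluing that describes the class of `p'`; it avoids analysing
  -- the generated equivalence relation.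
  let P : Glue φ → Prop := Quot.lift (Sum.elim (fun a => a = p') fun q => ∃ b : Bd Y₁, b = p' ∧
    (φ b : Y₂) = q) fun _ _ hr => by
      induction hr with
      | glue x =>
        simp only [Sum.elim_inl, Sum.elim_inr, eq_iff_iff]
        refine ⟨fun hx => ⟨x, hx, rfl⟩, fun ⟨b, hb, hbx⟩ => ?_⟩
        rw [← hb, φ.injective (Subtype.ext hbx)]
  have h' : P (inl φ p) := by rw [h]; exact (rfl : p' = p')
  exact h'

theorem exists_of_inl_eq_inr {p : Y₁} {q : Y₂} (h : inl φ p = inr φ q) :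
    ∃ b : Bd Y₁, (b : Y₁) = p ∧ (φ b : Y₂) = q := by
  let P : Glue φ → Prop := Quot.lift (Sum.elim (fun a => a = p) fun q => ∃ b : Bd Y₁, b = p ∧
    (φ b : Y₂) = q) fun _ _ hr => by
      induction hr with
      | glue x =>
        simp only [Sum.elim_inl, Sum.elim_inr, eq_iff_iff]
        refine ⟨fun hx => ⟨x, hx, rfl⟩, fun ⟨b, hb, hbx⟩ => ?_⟩
        rw [← hb, φ.injective (Subtype.ext hbx)]
  have h' : P (inr φ q) := by rw [← h]; exact (rfl : p = p)
  exact h'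

theorem inr_injective : Function.Injective (inr φ) := by
  intro q q' h
  let P : Glue φ → Prop := Quot.lift (Sum.elim (fun p => ∃ b : Bd Y₁, b = p ∧
    (φ b : Y₂) = q') fun a => a = q') fun _ _ hr => by
      induction hr with
      | glue x =>
        simp only [Sum.elim_inl, Sum.elim_inr, eq_iff_iff]
        refine ⟨fun ⟨b, hb, hbx⟩ => ?_, fun hx => ⟨x, rfl, hx⟩⟩
        rw [← hbx, Subtype.ext hb]
  have h' : P (inr φ q) := by rw [h]; exact (rfl : q' = q')
  exact h'

theorem isOpen_iff {W : Set (Glue φ)} :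
    IsOpen W ↔ IsOpen (inl φ ⁻¹' W) ∧ IsOpen (inr φ ⁻¹' W) := by
  rw [← isQuotientMap_quot_mk.isOpen_preimage, isOpen_sum_iff]
  rfl

theorem isClosed_iff {W : Set (Glue φ)} :
    IsClosed W ↔ IsClosed (inl φ ⁻¹' W) ∧ IsClosed (inr φ ⁻¹' W) := by
  simp only [← isOpen_compl_iff, isOpen_iff, Set.preimage_compl]

/-- A closed set of `Y₁` is seen in `Y₂` as the image under `φ` of its trace on the boundary, which
is closed because the boundary of `Y₂` is. -/
theorem isClosedEmbedding_inl (h₂ : IsClosed ((𝓡∂ 3).boundary Y₂)) :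
    Topology.IsClosedEmbedding (inl φ) := by
  refine .of_continuous_injective_isClosedMap (inl φ).continuous inl_injective fun C hC => ?_
  rw [isClosed_iff, Set.preimage_image_eq _ inl_injective]
  refine ⟨hC, ?_⟩
  have e : inr φ ⁻¹' (inl φ '' C) = Subtype.val '' (φ '' (Subtype.val ⁻¹' C)) := by
    ext q
    constructor
    · rintro ⟨p, hp, hpq⟩
      obtain ⟨b, rfl, rfl⟩ := exists_of_inl_eq_inr hpq
      exact ⟨_, ⟨b, hp, rfl⟩, rfl⟩
    · rintro ⟨_, ⟨b, hb, rfl⟩, rfl⟩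
      exact ⟨b, hb, inl_boundary φ b⟩
  rw [e]
  exact h₂.isClosedMap_subtype_val _ (φ.isClosedMap _ (hC.preimage continuous_subtype_val))

theorem isClosedEmbedding_inr (h₁ : IsClosed ((𝓡∂ 3).boundary Y₁)) :
    Topology.IsClosedEmbedding (inr φ) := by
  refine .of_continuous_injective_isClosedMap (inr φ).continuous inr_injective fun C hC => ?_
  rw [isClosed_iff, Set.preimage_image_eq _ inr_injective]
  refine ⟨?_, hC⟩
  have e : inl φ ⁻¹' (inr φ '' C) = Subtype.val '' (φ ⁻¹' (Subtype.val ⁻¹' C)) := by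
    ext p
    constructor
    · rintro ⟨q, hq, hpq⟩
      obtain ⟨b, rfl, rfl⟩ := exists_of_inl_eq_inr hpq.symm
      exact ⟨b, hq, rfl⟩
    · rintro ⟨b, hb, rfl⟩
      exact ⟨_, hb, (inl_boundary φ b).symm⟩
  rw [e]
  exact h₁.isClosedMap_subtype_val _
    ((hC.preimage continuous_subtype_val).preimage φ.continuous)

variable (φ) in
/-- The points of `Y₁ ∪_φ Y₂` whose preimages in `Y₁` and `Y₂` lie in `A₁` and `A₂`. -/
def core (A₁ : Set Y₁) (A₂ : Set Y₂) : Set (Glue φ) :=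
  (inl φ '' A₁ᶜ ∪ inr φ '' A₂ᶜ)ᶜ

theorem isOpen_core (h₁ : IsClosed ((𝓡∂ 3).boundary Y₁)) (h₂ : IsClosed ((𝓡∂ 3).boundary Y₂))
    {A₁ : Set Y₁} {A₂ : Set Y₂} (hA₁ : IsOpen A₁) (hA₂ : IsOpen A₂) : IsOpen (core φ A₁ A₂) :=
  (((isClosedEmbedding_inl h₂).isClosedMap _ hA₁.isClosed_compl).union
    ((isClosedEmbedding_inr h₁).isClosedMap _ hA₂.isClosed_compl)).isOpen_compl

theorem mem_of_inl_mem_core {A₁ : Set Y₁} {A₂ : Set Y₂} {p : Y₁} (h : inl φ p ∈ core φ A₁ A₂) :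
    p ∈ A₁ := by
  by_contra hp
  exact h (Or.inl ⟨p, hp, rfl⟩)

theorem mem_of_inr_mem_core {A₁ : Set Y₁} {A₂ : Set Y₂} {q : Y₂} (h : inr φ q ∈ core φ A₁ A₂) :
    q ∈ A₂ := by
  by_contra hq
  exact h (Or.inr ⟨q, hq, rfl⟩)

theorem inl_boundary_mem_core {A₁ : Set Y₁} {A₂ : Set Y₂} {b : Bd Y₁} (h₁ : (b : Y₁) ∈ A₁)
    (h₂ : (φ b : Y₂) ∈ A₂) : inl φ b ∈ core φ A₁ A₂ := by
  rintro (⟨p, hp, hpb⟩ | ⟨q, hq, hqb⟩)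
  · rw [inl_injective hpb] at hp
    exact hp h₁
  · rw [inl_boundary] at hqb
    rw [inr_injective hqb] at hq
    exact hq h₂

theorem inl_mem_core {A₁ : Set Y₁} {A₂ : Set Y₂} {p : Y₁} (h : p ∈ A₁)
    (hp : p ∉ (𝓡∂ 3).boundary Y₁) : inl φ p ∈ core φ A₁ A₂ := by
  rintro (⟨p', hp', hpp⟩ | ⟨q, hq, hqp⟩)
  · rw [inl_injective hpp] at hp'
    exact hp' h
  · obtain ⟨b, rfl, -⟩ := exists_of_inl_eq_inr hqp.symm
    exact hp b.2

theorem inr_mem_core {A₁ : Set Y₁} {A₂ : Set Y₂} {q : Y₂} (h : q ∈ A₂)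
    (hq : q ∉ (𝓡∂ 3).boundary Y₂) : inr φ q ∈ core φ A₁ A₂ := by
  rintro (⟨p, hp, hpq⟩ | ⟨q', hq', hqq⟩)
  · obtain ⟨b, -, rfl⟩ := exists_of_inl_eq_inr hpq
    exact hq (φ b).2
  · rw [inr_injective hqq] at hq'
    exact hq' h

end Glue

theorem exists_path_lift_of_isEmbedding {X Z : Type*} [TopologicalSpace X] [TopologicalSpace Z]
    {f : X → Z} (hf : Topology.IsEmbedding f) {p q : Z} (γ : Path p q)
    (h : ∀ t, γ t ∈ Set.range f) : ∃ (a b : X) (δ : Path a b), ∀ t, f (δ t) = γ t := by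
  choose g hg using h
  have hc : Continuous g := by
    rw [hf.isInducing.continuous_iff]
    exact γ.continuous.congr fun t => (hg t).symm
  exact ⟨g 0, g 1, ⟨⟨g, hc⟩, rfl, rfl⟩, hg⟩

theorem continuousOn_invFun_of_isEmbedding {X Z : Type*} [Nonempty X] [TopologicalSpace X]
    [TopologicalSpace Z] {f : X → Z} (hf : Topology.IsEmbedding f) :
    ContinuousOn (Function.invFun f) (Set.range f) := by
  rw [hf.isInducing.continuousOn_iff]
  exact continuousOn_id.congr fun z hz => Function.invFun_eq hz

theorem continuous_of_continuousOn_isClosed_union {X Z : Type*} [TopologicalSpace X]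
    [TopologicalSpace Z] {f : X → Z} {A B : Set X} (hA : IsClosed A) (hB : IsClosed B)
    (hAB : ∀ x, x ∈ A ∨ x ∈ B) (hfA : ContinuousOn f A) (hfB : ContinuousOn f B) :
    Continuous f := by
  rw [← continuousOn_univ, ← Set.eq_univ_of_forall hAB]
  exact hfA.union_of_isClosed hfB hA hB

/-! ### Generation: paths in the glued space come from the pieces -/

section Generation

variable [T2Space Y₁] [SecondCountableTopology Y₁] [T2Space Y₂] [SecondCountableTopology Y₂]
  {φ : Bd Y₁ ≃ₜ Bd Y₂} {G : Type*} [Group G]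

/-- By `toFun_mem_of_locally` only short paths matter. Away from the seam they stay in one piece.
Near the seam a path may cross it infinitely often, so it is slid as a whole into `Y₁`; during the
slide each end point stays in its own piece. -/
theorem PathHom.toFun_mem_of_glue (hY₁ : HasTorusBoundary Y₁) (hY₂ : HasTorusBoundary Y₂)
    (F : PathHom (Glue φ) G) (H : Subgroup G)
    (h₁ : ∀ (p q : Y₁) (γ : Path p q), (F.comap (Glue.inl φ)).toFun γ ∈ H)
    (h₂ : ∀ (p q : Y₂) (γ : Path p q), (F.comap (Glue.inr φ)).toFun γ ∈ H)
    {p q : Glue φ} (γ : Path p q) : F.toFun γ ∈ H := by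
  have hemb₁ := Glue.isClosedEmbedding_inl (φ := φ) hY₂.isClosed
  have hemb₂ := Glue.isClosedEmbedding_inr (φ := φ) hY₁.isClosed
  have hinl : ∀ {p q : Glue φ} (γ : Path p q), (∀ t, γ t ∈ Set.range (Glue.inl φ)) →
      F.toFun γ ∈ H := fun γ hγ => by
    obtain ⟨a, b, δ, hδ⟩ := exists_path_lift_of_isEmbedding hemb₁.isEmbedding γ hγ
    rw [← F.congr_of_forall_eq (δ.map (Glue.inl φ).continuous) γ hδ]
    exact h₁ a b δ
  have hinr : ∀ {p q : Glue φ} (γ : Path p q), (∀ t, γ t ∈ Set.range (Glue.inr φ)) →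
      F.toFun γ ∈ H := fun γ hγ => by
    obtain ⟨a, b, δ, hδ⟩ := exists_path_lift_of_isEmbedding hemb₂.isEmbedding γ hγ
    rw [← F.congr_of_forall_eq (δ.map (Glue.inr φ).continuous) γ hδ]
    exact h₂ a b δ
  refine F.toFun_mem_of_locally H (fun z => ?_) γ
  by_cases hz₂ : z ∉ Set.range (Glue.inr φ)
  · refine ⟨_, hemb₂.isClosed_range.isOpen_compl, hz₂, fun p q γ hγ => hinl γ fun t => ?_⟩
    exact (Glue.exists_inl_or_inr (γ t)).resolve_right (hγ ⟨t, rfl⟩)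
  by_cases hz₁ : z ∉ Set.range (Glue.inl φ)
  · refine ⟨_, hemb₁.isClosed_range.isOpen_compl, hz₁, fun p q γ hγ => hinr γ fun t => ?_⟩
    exact (Glue.exists_inl_or_inr (γ t)).resolve_left (hγ ⟨t, rfl⟩)
  rw [not_not] at hz₁ hz₂
  obtain ⟨p₀, rfl⟩ := hz₁
  obtain ⟨q₀, hq₀⟩ := hz₂
  obtain ⟨b, rfl, rfl⟩ := Glue.exists_of_inl_eq_inr hq₀.symm
  obtain ⟨V₁, c₁, hV₁, hbV₁, -, hc₁⟩ := exists_equiconnecting (b : Y₁) isOpen_univ trivial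
  obtain ⟨V₂, c₂, hV₂, hbV₂, -, hc₂⟩ := exists_equiconnecting (φ b : Y₂) isOpen_univ trivial
  obtain ⟨N₁, r₁, hN₁, hbN₁, hr₁, hr₁b⟩ := hY₁.exists_retraction
  obtain ⟨N₂, r₂, hN₂, hbN₂, hr₂, hr₂b⟩ := hY₂.exists_retraction
  -- Both a point and its retraction must lie in `V₁` for `c₁` to connect them.
  let A₁ : Set Y₁ := V₁ ∩ (N₁ ∩ r₁ ⁻¹' (Subtype.val ⁻¹' V₁))
  let A₂ : Set Y₂ := V₂ ∩ (N₂ ∩ r₂ ⁻¹' (Subtype.val ⁻¹' V₂))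
  have hA₁ : IsOpen A₁ :=
    hV₁.inter (hr₁.isOpen_inter_preimage hN₁ (hV₁.preimage continuous_subtype_val))
  have hA₂ : IsOpen A₂ :=
    hV₂.inter (hr₂.isOpen_inter_preimage hN₂ (hV₂.preimage continuous_subtype_val))
  have hbA₁ : (b : Y₁) ∈ A₁ := ⟨hbV₁, hbN₁ b, by simpa [hr₁b] using hbV₁⟩
  have hbA₂ : (φ b : Y₂) ∈ A₂ := ⟨hbV₂, hbN₂ _, by simpa [hr₂b] using hbV₂⟩
  refine ⟨Glue.core φ A₁ A₂, Glue.isOpen_core hY₁.isClosed hY₂.isClosed hA₁ hA₂,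
    Glue.inl_boundary_mem_core hbA₁ hbA₂, fun p q γ hγ => ?_⟩
  have : Nonempty Y₁ := ⟨b⟩
  have : Nonempty Y₂ := ⟨φ b⟩
  have hγ' : ∀ t, γ t ∈ Glue.core φ A₁ A₂ := fun t => hγ ⟨t, rfl⟩
  let g₁ : Glue φ → Y₁ := Function.invFun (Glue.inl φ)
  let g₂ : Glue φ → Y₂ := Function.invFun (Glue.inr φ)
  have hg₁ : ∀ p, g₁ (Glue.inl φ p) = p := Function.leftInverse_invFun Glue.inl_injective
  have hg₂ : ∀ q, g₂ (Glue.inr φ q) = q := Function.leftInverse_invFun Glue.inr_injective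
  have hg₁c : ContinuousOn g₁ (Set.range (Glue.inl φ)) :=
    continuousOn_invFun_of_isEmbedding hemb₁.isEmbedding
  have hg₂c : ContinuousOn g₂ (Set.range (Glue.inr φ)) :=
    continuousOn_invFun_of_isEmbedding hemb₂.isEmbedding
  classical
  -- Slide each point to its retraction on the torus. The two formulas agree on the seam, where the
  -- retraction is the identity and `c₁`, `c₂` are constant.
  let K : Glue φ → I → Glue φ := fun z s =>
    if z ∈ Set.range (Glue.inl φ) then Glue.inl φ (c₁ (g₁ z) (r₁ (g₁ z)) s)
    else Glue.inr φ (c₂ (g₂ z) (r₂ (g₂ z)) s)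
  have hK₁ : ∀ p s, K (Glue.inl φ p) s = Glue.inl φ (c₁ p (r₁ p) s) := fun p s => by
    simp only [K, if_pos (Set.mem_range_self p), hg₁]
  have hK₂ : ∀ q s, Glue.inr φ q ∈ Glue.core φ A₁ A₂ →
      K (Glue.inr φ q) s = Glue.inr φ (c₂ q (r₂ q) s) := fun q s hq => by
    by_cases h : Glue.inr φ q ∈ Set.range (Glue.inl φ)
    · obtain ⟨p, hp⟩ := h
      obtain ⟨d, rfl, rfl⟩ := Glue.exists_of_inl_eq_inr hp
      have hd₂ := Glue.mem_of_inr_mem_core hq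
      rw [← hp] at hq
      have hd₁ := Glue.mem_of_inl_mem_core hq
      rw [← hp, hK₁, hr₁b, hr₂b, hc₁.diag _ hd₁.1, hc₂.diag _ hd₂.1, hp]
    · simp only [K, if_neg h, hg₂]
  have hKc : Continuous fun z : I × I => K (γ z.2) z.1 := by
    have hγ2 : Continuous fun z : I × I => γ z.2 := γ.continuous.comp continuous_snd
    refine continuous_of_continuousOn_isClosed_union (hemb₁.isClosed_range.preimage hγ2)
      (hemb₂.isClosed_range.preimage hγ2) (fun z => Glue.exists_inl_or_inr _) ?_ ?_
    · have hA : ∀ z : I × I, γ z.2 ∈ Set.range (Glue.inl φ) → g₁ (γ z.2) ∈ A₁ := fun z hz => by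
        obtain ⟨p, hp⟩ := hz
        have h := hγ' z.2
        rw [← hp] at h ⊢
        rw [hg₁]
        exact Glue.mem_of_inl_mem_core h
      have h1 : ContinuousOn (fun z : I × I => g₁ (γ z.2))
          ((fun z : I × I => γ z.2) ⁻¹' Set.range (Glue.inl φ)) :=
        hg₁c.comp hγ2.continuousOn fun z hz => hz
      have h2 : ContinuousOn (fun z : I × I => (r₁ (g₁ (γ z.2)) : Y₁))
          ((fun z : I × I => γ z.2) ⁻¹' Set.range (Glue.inl φ)) :=
        continuous_subtype_val.comp_continuousOn (hr₁.comp h1 fun z hz => (hA z hz).2.1)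
      have h3 := hc₁.continuousOn.comp (h1.prodMk (h2.prodMk continuous_fst.continuousOn))
        fun z hz => ⟨(hA z hz).1, (hA z hz).2.2, Set.mem_univ _⟩
      refine ((Glue.inl φ).continuous.comp_continuousOn h3).congr fun z hz => ?_
      obtain ⟨p, hp⟩ := hz
      simp only [Function.comp_apply, ← hp, hK₁, hg₁]
    · have hA : ∀ z : I × I, γ z.2 ∈ Set.range (Glue.inr φ) → g₂ (γ z.2) ∈ A₂ := fun z hz => by
        obtain ⟨p, hp⟩ := hz
        have h := hγ' z.2
        rw [← hp] at h ⊢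
        rw [hg₂]
        exact Glue.mem_of_inr_mem_core h
      have h1 : ContinuousOn (fun z : I × I => g₂ (γ z.2))
          ((fun z : I × I => γ z.2) ⁻¹' Set.range (Glue.inr φ)) :=
        hg₂c.comp hγ2.continuousOn fun z hz => hz
      have h2 : ContinuousOn (fun z : I × I => (r₂ (g₂ (γ z.2)) : Y₂))
          ((fun z : I × I => γ z.2) ⁻¹' Set.range (Glue.inr φ)) :=
        continuous_subtype_val.comp_continuousOn (hr₂.comp h1 fun z hz => (hA z hz).2.1)
      have h3 := hc₂.continuousOn.comp (h1.prodMk (h2.prodMk continuous_fst.continuousOn))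
        fun z hz => ⟨(hA z hz).1, (hA z hz).2.2, Set.mem_univ _⟩
      refine ((Glue.inr φ).continuous.comp_continuousOn h3).congr fun z hz => ?_
      obtain ⟨p, hp : Glue.inr φ p = γ z.2⟩ := hz
      have h := hγ' z.2
      rw [← hp] at h
      simp only [Function.comp_apply, ← hp, hK₂ _ _ h, hg₂]
  have hK0 : ∀ z ∈ Glue.core φ A₁ A₂, K z 0 = z := fun z hz => by
    rcases Glue.exists_inl_or_inr z with ⟨p, rfl⟩ | ⟨q, rfl⟩
    · have h := Glue.mem_of_inl_mem_core hz
      rw [hK₁, hc₁.zero _ h.1 _ h.2.2]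
    · have h := Glue.mem_of_inr_mem_core hz
      rw [hK₂ _ _ hz, hc₂.zero _ h.1 _ h.2.2]
  have hK1 : ∀ z ∈ Glue.core φ A₁ A₂, K z 1 ∈ Set.range (Glue.inl φ) := fun z hz => by
    rcases Glue.exists_inl_or_inr z with ⟨p, rfl⟩ | ⟨q, rfl⟩
    · rw [hK₁]
      exact Set.mem_range_self _
    · have h := Glue.mem_of_inr_mem_core hz
      rw [hK₂ _ _ hz, hc₂.one _ h.1 _ h.2.2]
      -- The slide in `Y₂` ends on the torus, which is also contained in `Y₁`.
      exact ⟨φ.symm (r₂ q), by rw [Glue.inl_boundary, φ.apply_symm_apply]⟩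
  let side : ∀ z, z ∈ Glue.core φ A₁ A₂ → (Continuous fun s => K z s) → Path z (K z 1) :=
    fun z hz hc => ⟨⟨fun s => K z s, hc⟩, hK0 z hz, rfl⟩
  have hside : ∀ z hz hc, F.toFun (side z hz hc) ∈ H := fun z hz hc => by
    rcases Glue.exists_inl_or_inr z with ⟨p, rfl⟩ | ⟨q, rfl⟩
    · exact hinl _ fun t => ⟨_, (hK₁ p t).symm⟩
    · exact hinr _ fun t => ⟨_, (hK₂ q t hz).symm⟩
  have hp : p ∈ Glue.core φ A₁ A₂ := by simpa using hγ' 0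
  have hq : q ∈ Glue.core φ A₁ A₂ := by simpa using hγ' 1
  have hcp : Continuous fun s => K p s := by
    have h := hKc.comp (g := fun z : I × I => K (γ z.2) z.1) (f := fun s => (s, 0)) (by fun_prop)
    simpa [Function.comp_def] using h
  have hcq : Continuous fun s => K q s := by
    have h := hKc.comp (g := fun z : I × I => K (γ z.2) z.1) (f := fun s => (s, 1)) (by fun_prop)
    simpa [Function.comp_def] using h
  let top : Path (K p 1) (K q 1) :=
    ⟨⟨fun t => K (γ t) 1, hKc.comp (by fun_prop : Continuous fun t : I => ((1 : I), t))⟩,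
      by simp, by simp⟩
  have key := F.toFun_mul_eq_of_square ⟨_, hKc⟩ γ (side q hq hcq) (side p hp hcp) top
    (fun t => (hK0 _ (hγ' t)).symm) (fun t => by simp [side]) (fun t => by simp [side])
    (fun t => rfl)
  have htop : F.toFun top ∈ H := hinl top fun t => hK1 _ (hγ' t)
  rw [← H.mul_mem_cancel_left (hside q hq hcq), key]
  exact H.mul_mem htop (hside p hp hcp)

end Generation

end Glue

/-! ### Existence: gluing compatible groupoid homomorphisms -/

section Existence

variable {Y₁ Y₂ : Type*}
  [TopologicalSpace Y₁] [ChartedSpace (EuclideanHalfSpace 3) Y₁]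
  [TopologicalSpace Y₂] [ChartedSpace (EuclideanHalfSpace 3) Y₂]
  {φ : Bd Y₁ ≃ₜ Bd Y₂} {G : Type*} [Group G]

/-- On `W`, the function `f` trivializes both `F₁` and `F₂`. -/
def IsPotential (F₁ : PathHom Y₁ G) (F₂ : PathHom Y₂ G) (W : Set (Glue φ)) (f : Glue φ → G) :
    Prop :=
  (∀ ⦃p q : Y₁⦄ (γ : Path p q), Set.range γ ⊆ Glue.inl φ ⁻¹' W →
    f (Glue.inl φ q) = F₁.toFun γ * f (Glue.inl φ p)) ∧
  ∀ ⦃p q : Y₂⦄ (γ : Path p q), Set.range γ ⊆ Glue.inr φ ⁻¹' W →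
    f (Glue.inr φ q) = F₂.toFun γ * f (Glue.inr φ p)

theorem IsPotential.mul_right {F₁ : PathHom Y₁ G} {F₂ : PathHom Y₂ G} {W : Set (Glue φ)}
    {f : Glue φ → G} (h : IsPotential F₁ F₂ W f) (g : G) :
    IsPotential F₁ F₂ W fun z => f z * g :=
  ⟨fun p q γ hγ => by simp only [h.1 γ hγ, mul_assoc], fun p q γ hγ => by simp only [h.2 γ hγ, mul_assoc]⟩

theorem range_trans_subset {X : Type*} [TopologicalSpace X] {p q r : X} {γ : Path p q}
    {δ : Path q r} {V : Set X} (hγ : Set.range γ ⊆ V) (hδ : Set.range δ ⊆ V) :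
    Set.range (γ.trans δ) ⊆ V := by
  rw [Path.trans_range]
  exact Set.union_subset hγ hδ

/-- Set `f` equal to transport from `b₁` or `b₂` inside `V₁` or `V₂`, which is independent of the
path; `hagree` reconciles the two values on the seam. A side that `W` misses imposes no condition.
-/
theorem exists_potential_of_equiconnecting {F₁ : PathHom Y₁ G} {F₂ : PathHom Y₂ G}
    {V₁ : Set Y₁} {c₁ : Y₁ → Y₁ → I → Y₁} (hc₁ : IsEquiconnecting V₁ c₁)
    {V₂ : Set Y₂} {c₂ : Y₂ → Y₂ → I → Y₂} (hc₂ : IsEquiconnecting V₂ c₂) {b₁ : Y₁} {b₂ : Y₂}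
    {W : Set (Glue φ)} (hW₁ : ∀ p, Glue.inl φ p ∈ W → p ∈ V₁ ∧ b₁ ∈ V₁)
    (hW₂ : ∀ q, Glue.inr φ q ∈ W → q ∈ V₂ ∧ b₂ ∈ V₂)
    (hagree : ∀ d : Bd Y₁, Glue.inl φ d ∈ W → ∃ (γ₁ : Path b₁ (d : Y₁)) (γ₂ : Path b₂ (φ d : Y₂)),
      Set.range γ₁ ⊆ V₁ ∧ Set.range γ₂ ⊆ V₂ ∧ F₁.toFun γ₁ = F₂.toFun γ₂) :
    ∃ f : Glue φ → G, IsPotential F₁ F₂ W f := by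
  have hex : ∀ z : Glue φ, ∃ v : G, z ∈ W →
      (∀ (p : Y₁) (γ : Path b₁ p), Glue.inl φ p = z → Set.range γ ⊆ V₁ → v = F₁.toFun γ) ∧
      ∀ (q : Y₂) (γ : Path b₂ q), Glue.inr φ q = z → Set.range γ ⊆ V₂ → v = F₂.toFun γ := by
    intro z
    by_cases hz : z ∈ W
    swap
    · exact ⟨1, fun h => absurd h hz⟩
    by_cases hd : ∃ d : Bd Y₁, Glue.inl φ d = z
    · obtain ⟨d, rfl⟩ := hd
      obtain ⟨γ₁, γ₂, hγ₁, hγ₂, e⟩ := hagree d hz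
      refine ⟨F₁.toFun γ₁, fun _ => ⟨fun p γ hp hγ => ?_, fun q γ hq hγ => ?_⟩⟩
      · obtain rfl := Glue.inl_injective hp
        exact hc₁.toFun_eq F₁ _ _ hγ₁ hγ
      · rw [Glue.inl_boundary] at hq
        obtain rfl := Glue.inr_injective hq
        rw [e]
        exact hc₂.toFun_eq F₂ _ _ hγ₂ hγ
    · rcases Glue.exists_inl_or_inr z with ⟨p, rfl⟩ | ⟨q, rfl⟩
      · obtain ⟨γ₁, hγ₁⟩ := hc₁.exists_path (hW₁ p hz).2 (hW₁ p hz).1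
        refine ⟨F₁.toFun γ₁, fun _ => ⟨fun p' γ hp hγ => ?_, fun q γ hq hγ => ?_⟩⟩
        · obtain rfl := Glue.inl_injective hp
          exact hc₁.toFun_eq F₁ _ _ hγ₁ hγ
        · obtain ⟨d, rfl, -⟩ := Glue.exists_of_inl_eq_inr hq.symm
          exact absurd ⟨d, rfl⟩ hd
      · obtain ⟨γ₂, hγ₂⟩ := hc₂.exists_path (hW₂ q hz).2 (hW₂ q hz).1
        refine ⟨F₂.toFun γ₂, fun _ => ⟨fun p γ hp hγ => ?_, fun q' γ hq hγ => ?_⟩⟩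
        · obtain ⟨d, rfl, -⟩ := Glue.exists_of_inl_eq_inr hp
          exact absurd ⟨d, hp⟩ hd
        · obtain rfl := Glue.inr_injective hq
          exact hc₂.toFun_eq F₂ _ _ hγ₂ hγ
  choose f hf using hex
  refine ⟨f, fun p q γ hγ => ?_, fun p q γ hγ => ?_⟩
  · have hp : Glue.inl φ p ∈ W := by simpa using hγ ⟨0, rfl⟩
    have hq : Glue.inl φ q ∈ W := by simpa using hγ ⟨1, rfl⟩
    obtain ⟨δ, hδ⟩ := hc₁.exists_path (hW₁ p hp).2 (hW₁ p hp).1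
    rw [(hf _ hp).1 p δ rfl hδ, ← F₁.map_trans]
    exact (hf _ hq).1 q _ rfl (range_trans_subset hδ (hγ.trans fun a ha => (hW₁ a ha).1))
  · have hp : Glue.inr φ p ∈ W := by simpa using hγ ⟨0, rfl⟩
    have hq : Glue.inr φ q ∈ W := by simpa using hγ ⟨1, rfl⟩
    obtain ⟨δ, hδ⟩ := hc₂.exists_path (hW₂ p hp).2 (hW₂ p hp).1
    rw [(hf _ hp).2 p δ rfl hδ, ← F₂.map_trans]
    exact (hf _ hq).2 q _ rfl (range_trans_subset hδ (hγ.trans fun a ha => (hW₂ a ha).1))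

theorem isEquiconnecting_empty {X : Type*} [TopologicalSpace X] :
    IsEquiconnecting (∅ : Set X) fun p _ _ => p where
  continuousOn := by simp
  mapsTo _ hp := hp.elim
  zero _ hp := hp.elim
  one _ hp := hp.elim
  diag _ hp := hp.elim

/-- Along a short path in one piece both potentials are multiplied on the left by the same element,
which cancels in the quotient. -/
theorem IsPotential.eventually_eq {F₁ : PathHom Y₁ G} {F₂ : PathHom Y₂ G} {W W' : Set (Glue φ)}
    {f f' : Glue φ → G} (hW : IsOpen W) (hW' : IsOpen W') (h : IsPotential F₁ F₂ W f)
    (h' : IsPotential F₁ F₂ W' f') {z : Glue φ} (hz : z ∈ W ∩ W') :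
    ∀ᶠ w in nhds z, (f' w)⁻¹ * f w = (f' z)⁻¹ * f z := by
  have hopen : IsOpen {w | w ∈ W ∩ W' ∧ (f' w)⁻¹ * f w = (f' z)⁻¹ * f z} := by
    rw [Glue.isOpen_iff]
    constructor
    · rw [isOpen_iff_mem_nhds]
      rintro p ⟨hpW, hp⟩
      obtain ⟨V, c, hV, hpV, hVW, hc⟩ := exists_equiconnecting p
        ((hW.inter hW').preimage (Glue.inl φ).continuous) hpW
      filter_upwards [hV.mem_nhds hpV] with p' hp'
      obtain ⟨γ, hγ⟩ := hc.exists_path hpV hp'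
      refine ⟨hVW hp', ?_⟩
      rw [h.1 γ ((hγ.trans hVW).trans fun a ha => ha.1),
        h'.1 γ ((hγ.trans hVW).trans fun a ha => ha.2), ← hp]
      group
    · rw [isOpen_iff_mem_nhds]
      rintro p ⟨hpW, hp⟩
      obtain ⟨V, c, hV, hpV, hVW, hc⟩ := exists_equiconnecting p
        ((hW.inter hW').preimage (Glue.inr φ).continuous) hpW
      filter_upwards [hV.mem_nhds hpV] with p' hp'
      obtain ⟨γ, hγ⟩ := hc.exists_path hpV hp'
      refine ⟨hVW hp', ?_⟩
      rw [h.2 γ ((hγ.trans hVW).trans fun a ha => ha.1),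
        h'.2 γ ((hγ.trans hVW).trans fun a ha => ha.2), ← hp]
      group
  filter_upwards [hopen.mem_nhds ⟨hz, rfl⟩] with w hw using hw.2

variable [T2Space Y₁] [T2Space Y₂]

theorem exists_potential (hY₁ : HasTorusBoundary Y₁) (hY₂ : HasTorusBoundary Y₂)
    (F₁ : PathHom Y₁ G) (F₂ : PathHom Y₂ G)
    (hF : ∀ (p q : Bd Y₁) (ξ : Path p q), F₁.toFun (ξ.map (bdIncl Y₁).continuous) =
      F₂.toFun ((ξ.map φ.continuous).map (bdIncl Y₂).continuous)) (z : Glue φ) :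
    ∃ (W : Set (Glue φ)) (f : Glue φ → G), IsOpen W ∧ z ∈ W ∧ f z = 1 ∧
      IsPotential F₁ F₂ W f := by
  suffices h : ∃ (W : Set (Glue φ)) (f : Glue φ → G), IsOpen W ∧ z ∈ W ∧
      IsPotential F₁ F₂ W f by
    obtain ⟨W, f, hW, hz, hf⟩ := h
    exact ⟨W, _, hW, hz, mul_inv_cancel (f z), hf.mul_right _⟩
  have hne₁ : Nonempty (Bd Y₁) := by
    obtain ⟨h⟩ := hY₁
    exact ⟨h.symm 1⟩
  have b₀ : Bd Y₁ := hne₁.some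
  by_cases hd : ∃ b : Bd Y₁, Glue.inl φ b = z
  · obtain ⟨b, rfl⟩ := hd
    obtain ⟨V₁, c₁, hV₁, hbV₁, -, hc₁⟩ := exists_equiconnecting (b : Y₁) isOpen_univ trivial
    obtain ⟨V₂, c₂, hV₂, hbV₂, -, hc₂⟩ := exists_equiconnecting (φ b : Y₂) isOpen_univ trivial
    have := hY₁.locallyPathConnectedSpace
    have hO : IsOpen {d : Bd Y₁ | (d : Y₁) ∈ V₁ ∧ (φ d : Y₂) ∈ V₂} :=
      (hV₁.preimage continuous_subtype_val).inter
        (hV₂.preimage (continuous_subtype_val.comp φ.continuous))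
    -- Seam points near `b` must be joined to it within the torus, since only there do `F₁` and `F₂`
    -- agree. The rest of the boundary is cut out of `V₁` next.
    obtain ⟨D, ⟨hD, hbD, hDc⟩, hDsub⟩ :=
      (isOpen_isPathConnected_basis b).mem_iff.mp
        (hO.mem_nhds ⟨hbV₁, hbV₂⟩)
    let A₁ : Set Y₁ := V₁ \ (Subtype.val '' Dᶜ)
    have hA₁ : IsOpen A₁ :=
      hV₁.sdiff (hY₁.isClosed.isClosedMap_subtype_val _ hD.isClosed_compl)
    have hbA₁ : (b : Y₁) ∈ A₁ := by
      refine ⟨hbV₁, ?_⟩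
      rintro ⟨d, hd, hdb⟩
      exact hd (Subtype.ext hdb ▸ hbD)
    refine ⟨Glue.core φ A₁ V₂, ?_⟩
    obtain ⟨f, hf⟩ := exists_potential_of_equiconnecting (F₁ := F₁) (F₂ := F₂) hc₁ hc₂
      (b₁ := b) (b₂ := φ b) (W := Glue.core φ A₁ V₂)
      (fun p hp => ⟨(Glue.mem_of_inl_mem_core hp).1, hbV₁⟩)
      (fun q hq => ⟨Glue.mem_of_inr_mem_core hq, hbV₂⟩) fun d hd => by
        have hdA := Glue.mem_of_inl_mem_core hd
        have hdD : d ∈ D := by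
          by_contra h
          exact hdA.2 ⟨d, h, rfl⟩
        obtain ⟨ξ, hξ⟩ := hDc.joinedIn b hbD d hdD
        refine ⟨ξ.map (bdIncl Y₁).continuous,
          (ξ.map φ.continuous).map (bdIncl Y₂).continuous, ?_, ?_, hF _ _ ξ⟩
        · rintro _ ⟨t, rfl⟩
          exact (hDsub (hξ t)).1
        · rintro _ ⟨t, rfl⟩
          exact (hDsub (hξ t)).2
    exact ⟨f, Glue.isOpen_core hY₁.isClosed hY₂.isClosed hA₁ hV₂,
      Glue.inl_boundary_mem_core hbA₁ hbV₂, hf⟩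
  · rcases Glue.exists_inl_or_inr z with ⟨p, rfl⟩ | ⟨q, rfl⟩
    · have hp : p ∉ (𝓡∂ 3).boundary Y₁ := fun h => hd ⟨⟨p, h⟩, rfl⟩
      obtain ⟨V₁, c₁, hV₁, hpV₁, -, hc₁⟩ := exists_equiconnecting p isOpen_univ trivial
      have hmiss : ∀ q : Y₂, Glue.inr φ q ∉ Glue.core φ V₁ ∅ := fun q hq =>
        Glue.mem_of_inr_mem_core hq
      obtain ⟨f, hf⟩ := exists_potential_of_equiconnecting (F₁ := F₁) (F₂ := F₂) hc₁
        isEquiconnecting_empty (b₁ := p) (b₂ := φ b₀) (W := Glue.core φ V₁ ∅)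
        (fun p hp => ⟨Glue.mem_of_inl_mem_core hp, hpV₁⟩)
        (fun q hq => absurd hq (hmiss q))
        fun d hd => absurd (Glue.inl_boundary φ d ▸ hd) (hmiss _)
      exact ⟨_, f, Glue.isOpen_core hY₁.isClosed hY₂.isClosed hV₁ isOpen_empty,
        Glue.inl_mem_core hpV₁ hp, hf⟩
    · have hq : q ∉ (𝓡∂ 3).boundary Y₂ := fun h => hd ⟨φ.symm ⟨q, h⟩, by
        rw [Glue.inl_boundary, φ.apply_symm_apply]⟩
      obtain ⟨V₂, c₂, hV₂, hqV₂, -, hc₂⟩ := exists_equiconnecting q isOpen_univ trivial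
      have hmiss : ∀ p : Y₁, Glue.inl φ p ∉ Glue.core φ ∅ V₂ := fun p hp =>
        Glue.mem_of_inl_mem_core hp
      obtain ⟨f, hf⟩ := exists_potential_of_equiconnecting (F₁ := F₁) (F₂ := F₂)
        isEquiconnecting_empty hc₂ (b₁ := b₀) (b₂ := q) (W := Glue.core φ ∅ V₂)
        (fun p hp => absurd hp (hmiss p))
        (fun q hq => ⟨Glue.mem_of_inr_mem_core hq, hqV₂⟩)
        fun d hd => absurd hd (hmiss _)
      exact ⟨_, f, Glue.isOpen_core hY₁.isClosed hY₂.isClosed isOpen_empty hV₂,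
        Glue.inr_mem_core hqV₂ hq, hf⟩

theorem exists_pathHom_glue (hY₁ : HasTorusBoundary Y₁) (hY₂ : HasTorusBoundary Y₂)
    (F₁ : PathHom Y₁ G) (F₂ : PathHom Y₂ G)
    (hF : ∀ (p q : Bd Y₁) (ξ : Path p q), F₁.toFun (ξ.map (bdIncl Y₁).continuous) =
      F₂.toFun ((ξ.map φ.continuous).map (bdIncl Y₂).continuous)) :
    ∃ F : PathHom (Glue φ) G,
      (∀ (p q : Y₁) (γ : Path p q), (F.comap (Glue.inl φ)).toFun γ = F₁.toFun γ) ∧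
      ∀ (p q : Y₂) (γ : Path p q), (F.comap (Glue.inr φ)).toFun γ = F₂.toFun γ := by
  choose W f hWo hW hf1 hf using exists_potential hY₁ hY₂ F₁ F₂ hF
  obtain ⟨F, hFs⟩ := exists_pathHom_of_localSystem W f hWo hW hf1 fun i j z hz =>
    (hf i).eventually_eq (hWo i) (hWo j) (hf j) hz
  refine ⟨F, fun p q γ => ?_, fun p q γ => ?_⟩
  -- The values of `F₁` on initial segments form a flat section, so the holonomy along `γ` is
  -- `F₁.toFun γ`.
  · have h := hFs _ _ (γ.map (Glue.inl φ).continuous) (fun t => F₁.toFun (γ.subpath 0 t))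
      fun t₀ => by
        filter_upwards [PathHom.eventually_range_subpath_subset γ t₀
          ((hWo _).preimage (Glue.inl φ).continuous) (hW (Glue.inl φ (γ t₀)))] with t ht
        have h := (hf (Glue.inl φ (γ t₀))).1 _ ht
        rw [hf1, mul_one] at h
        simp only [Path.map_coe, Function.comp_apply]
        rw [h, F₁.toFun_subpath γ 0 t₀ t, inv_mul_cancel_left]
    rw [F₁.toFun_subpath_zero_one] at h
    have h0 : F₁.toFun (γ.subpath 0 0) = 1 := by simpa using F₁.map_refl (γ 0)
    rw [h0, mul_one] at h
    exact h
  · have h := hFs _ _ (γ.map (Glue.inr φ).continuous) (fun t => F₂.toFun (γ.subpath 0 t))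
      fun t₀ => by
        filter_upwards [PathHom.eventually_range_subpath_subset γ t₀
          ((hWo _).preimage (Glue.inr φ).continuous) (hW (Glue.inr φ (γ t₀)))] with t ht
        have h := (hf (Glue.inr φ (γ t₀))).2 _ ht
        rw [hf1, mul_one] at h
        simp only [Path.map_coe, Function.comp_apply]
        rw [h, F₂.toFun_subpath γ 0 t₀ t, inv_mul_cancel_left]
    rw [F₂.toFun_subpath_zero_one] at h
    have h0 : F₂.toFun (γ.subpath 0 0) = 1 := by simpa using F₂.map_refl (γ 0)
    rw [h0, mul_one] at h
    exact h

end Existence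

/-! ### From groupoids to fundamental groups -/

section VanKampen

variable {Y₁ Y₂ : Type*}
  [TopologicalSpace Y₁] [ConnectedSpace Y₁] [ChartedSpace (EuclideanHalfSpace 3) Y₁]
  [TopologicalSpace Y₂] [ConnectedSpace Y₂] [ChartedSpace (EuclideanHalfSpace 3) Y₂]
  {φ : Bd Y₁ ≃ₜ Bd Y₂} {G : Type*} [Group G]

/-- Using the same connecting paths on the torus for both pieces makes the two `PathHom.ofHom` agree
there exactly. -/
theorem exists_paths_extending {X Z : Type*} [TopologicalSpace X] [TopologicalSpace Z]
    [PathConnectedSpace Z] (f : C(X, Z)) (hf : Function.Injective f) {x : X}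
    (τ : ∀ s, Path x s) : ∃ τ' : ∀ z, Path (f x) z, ∀ s, τ' (f s) = (τ s).map f.continuous := by
  have h : ∀ z, ∃ γ : Path (f x) z, ∀ s, f s = z → ∀ t, γ t = f (τ s t) := by
    intro z
    by_cases hz : ∃ s, f s = z
    · obtain ⟨s, rfl⟩ := hz
      refine ⟨(τ s).map f.continuous, fun s' hs' t => ?_⟩
      rw [hf hs']
      rfl
    · exact ⟨PathConnectedSpace.somePath _ _, fun s hs => absurd ⟨s, hs⟩ hz⟩
  choose τ' hτ' using h
  exact ⟨τ', fun s => Path.ext (funext fun t => hτ' (f s) s rfl t)⟩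

theorem exists_paths_refl (X : Type*) [TopologicalSpace X] [PathConnectedSpace X] (x : X) :
    ∃ τ : ∀ s, Path x s, τ x = Path.refl x := by
  classical
  refine ⟨fun s => if h : x = s then (Path.refl x).cast rfl h.symm else
    PathConnectedSpace.somePath x s, ?_⟩
  simp

theorem PathHom.ofHom_toFun_of_refl {X : Type*} [TopologicalSpace X] {x : X}
    (ρ : FundamentalGroup X x →* G) {τ : ∀ p, Path x p} (hτ : τ x = Path.refl x) (γ : Path x x) :
    (PathHom.ofHom ρ τ).toFun γ = ρ (Path.Homotopic.Quotient.mk γ) := by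
  simp only [PathHom.ofHom, hτ, Path.refl_symm, Path.Homotopic.Quotient.mk_trans,
    Path.Homotopic.Quotient.mk_refl, Path.Homotopic.Quotient.refl_trans,
    Path.Homotopic.Quotient.trans_refl]

theorem pathConnectedSpace_glue (x : Bd Y₁) : PathConnectedSpace (Glue φ) := by
  have := pathConnectedSpace_of_chartedSpace Y₁
  have := pathConnectedSpace_of_chartedSpace Y₂
  have key : ∀ z : Glue φ, Joined (Glue.inl φ x) z := fun z => by
    rcases Glue.exists_inl_or_inr z with ⟨p, rfl⟩ | ⟨q, rfl⟩
    · exact ⟨(PathConnectedSpace.somePath (x : Y₁) p).map (Glue.inl φ).continuous⟩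
    · rw [Glue.inl_boundary]
      exact ⟨(PathConnectedSpace.somePath (φ x : Y₂) q).map (Glue.inr φ).continuous⟩
  exact ⟨⟨Glue.inl φ x⟩, fun a b => (key a).symm.trans (key b)⟩

/-- A seam point is reached along a path in the torus, which serves both pieces at once. After this
gauge, transport along a path in a piece is transport around a loop at the base point in that piece.
-/
theorem exists_gauge (hY₁ : HasTorusBoundary Y₁) (F : PathHom (Glue φ) G) (x : Bd Y₁) :
    ∃ g : Glue φ → G,
      (∀ p, ∃ γ : Path (bdIncl Y₁ x) p, g (Glue.inl φ p) = (F.comap (Glue.inl φ)).toFun γ) ∧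
      ∀ q, ∃ γ : Path (bdIncl Y₂ (φ x)) q,
        g (Glue.inr φ q) = (F.comap (Glue.inr φ)).toFun γ := by
  have := pathConnectedSpace_of_chartedSpace Y₁
  have := pathConnectedSpace_of_chartedSpace Y₂
  have := hY₁.pathConnectedSpace
  have h : ∀ z : Glue φ, ∃ v : G,
      (∀ p, Glue.inl φ p = z → ∃ γ : Path (bdIncl Y₁ x) p,
        v = (F.comap (Glue.inl φ)).toFun γ) ∧
      ∀ q, Glue.inr φ q = z → ∃ γ : Path (bdIncl Y₂ (φ x)) q,
        v = (F.comap (Glue.inr φ)).toFun γ := by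
    intro z
    by_cases hd : ∃ d : Bd Y₁, Glue.inl φ d = z
    · obtain ⟨d, rfl⟩ := hd
      let ξ : Path x d := PathConnectedSpace.somePath x d
      refine ⟨(F.comap (Glue.inl φ)).toFun (ξ.map (bdIncl Y₁).continuous),
        fun p hp => ?_, fun q hq => ?_⟩
      · obtain rfl := Glue.inl_injective hp
        exact ⟨_, rfl⟩
      · rw [Glue.inl_boundary] at hq
        obtain rfl := Glue.inr_injective hq
        exact ⟨(ξ.map φ.continuous).map (bdIncl Y₂).continuous,
          F.congr_of_forall_eq _ _ fun t => Glue.inl_boundary φ (ξ t)⟩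
    · rcases Glue.exists_inl_or_inr z with ⟨p, rfl⟩ | ⟨q, rfl⟩
      · refine ⟨(F.comap (Glue.inl φ)).toFun (PathConnectedSpace.somePath (bdIncl Y₁ x) p),
          fun p' hp => ?_, fun q hq => ?_⟩
        · obtain rfl := Glue.inl_injective hp
          exact ⟨_, rfl⟩
        · obtain ⟨d, rfl, -⟩ := Glue.exists_of_inl_eq_inr hq.symm
          exact absurd ⟨d, rfl⟩ hd
      · refine ⟨(F.comap (Glue.inr φ)).toFun
            (PathConnectedSpace.somePath (bdIncl Y₂ (φ x)) q), fun p hp => ?_, fun q' hq => ?_⟩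
        · obtain ⟨d, rfl, -⟩ := Glue.exists_of_inl_eq_inr hp
          exact absurd ⟨d, hp⟩ hd
        · obtain rfl := Glue.inr_injective hq
          exact ⟨_, rfl⟩
  choose g hg using h
  exact ⟨g, fun p => (hg _).1 p rfl, fun q => (hg _).2 q rfl⟩

variable [T2Space Y₁] [T2Space Y₂]

theorem exists_pathHom_of_homs (hY₁ : HasTorusBoundary Y₁) (hY₂ : HasTorusBoundary Y₂)
    (x : Bd Y₁) (ρ₁ : FundamentalGroup Y₁ (bdIncl Y₁ x) →* G)
    (ρ₂ : FundamentalGroup Y₂ (bdIncl Y₂ (φ x)) →* G)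
    (hρ : ∀ ξ : Path x x, ρ₁ (Path.Homotopic.Quotient.mk (ξ.map (bdIncl Y₁).continuous)) =
      ρ₂ (Path.Homotopic.Quotient.mk ((ξ.map φ.continuous).map (bdIncl Y₂).continuous))) :
    ∃ F : PathHom (Glue φ) G,
      (∀ γ : Path (bdIncl Y₁ x) (bdIncl Y₁ x), (F.comap (Glue.inl φ)).toFun γ =
        ρ₁ (Path.Homotopic.Quotient.mk γ)) ∧
      ∀ γ : Path (bdIncl Y₂ (φ x)) (bdIncl Y₂ (φ x)), (F.comap (Glue.inr φ)).toFun γ =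
        ρ₂ (Path.Homotopic.Quotient.mk γ) := by
  have := pathConnectedSpace_of_chartedSpace Y₁
  have := pathConnectedSpace_of_chartedSpace Y₂
  have := hY₁.pathConnectedSpace
  obtain ⟨τ, hτ⟩ := exists_paths_refl (Bd Y₁) x
  obtain ⟨τ₁, hτ₁⟩ := exists_paths_extending (bdIncl Y₁) Subtype.val_injective τ
  let j : C(Bd Y₁, Y₂) := (bdIncl Y₂).comp (φ : C(Bd Y₁, Bd Y₂))
  obtain ⟨τ₂, hτ₂⟩ := exists_paths_extending j
    (Subtype.val_injective.comp φ.injective) τ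
  obtain ⟨F, hF₁, hF₂⟩ := exists_pathHom_glue (φ := φ) hY₁ hY₂ (PathHom.ofHom ρ₁ τ₁)
    (PathHom.ofHom ρ₂ τ₂) fun p q ξ => by
      have h := hρ (((τ p).trans ξ).trans (τ q).symm)
      simp only [PathHom.ofHom]
      have e₁ : ((τ₁ (bdIncl Y₁ p)).trans (ξ.map (bdIncl Y₁).continuous)).trans
          (τ₁ (bdIncl Y₁ q)).symm =
          (((τ p).trans ξ).trans (τ q).symm).map (bdIncl Y₁).continuous := by
        rw [hτ₁, hτ₁, Path.map_trans, Path.map_trans, Path.map_symm]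
      have e₂ : ((τ₂ (j p)).trans ((ξ.map φ.continuous).map (bdIncl Y₂).continuous)).trans
          (τ₂ (j q)).symm =
          ((((τ p).trans ξ).trans (τ q).symm).map φ.continuous).map (bdIncl Y₂).continuous := by
        rw [hτ₂, hτ₂]
        simp only [Path.map_trans, Path.map_symm]
        rfl
      exact (congr_arg (fun γ => ρ₁ (Path.Homotopic.Quotient.mk γ)) e₁).trans
        (h.trans (congr_arg (fun γ => ρ₂ (Path.Homotopic.Quotient.mk γ)) e₂).symm)
  refine ⟨F, fun γ => ?_, fun γ => ?_⟩
  · rw [hF₁]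
    refine PathHom.ofHom_toFun_of_refl ρ₁ ?_ γ
    rw [hτ₁, hτ]
    rfl
  · rw [hF₂]
    refine PathHom.ofHom_toFun_of_refl ρ₂ ?_ γ
    exact (hτ₂ x).trans (by rw [hτ]; rfl)

theorem exists_gauge_toFun_mem [SecondCountableTopology Y₁] [SecondCountableTopology Y₂]
    (hY₁ : HasTorusBoundary Y₁) (hY₂ : HasTorusBoundary Y₂) (F : PathHom (Glue φ) G)
    (x : Bd Y₁) (H : Subgroup G)
    (h₁ : ∀ γ : Path (bdIncl Y₁ x) (bdIncl Y₁ x), (F.comap (Glue.inl φ)).toFun γ ∈ H)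
    (h₂ : ∀ γ : Path (bdIncl Y₂ (φ x)) (bdIncl Y₂ (φ x)), (F.comap (Glue.inr φ)).toFun γ ∈ H) :
    ∃ g : Glue φ → G, ∀ (p q : Glue φ) (γ : Path p q), (F.gauge g).toFun γ ∈ H := by
  obtain ⟨g, hg₁, hg₂⟩ := exists_gauge hY₁ F x
  refine ⟨g, fun p q γ => (F.gauge g).toFun_mem_of_glue hY₁ hY₂ H ?_ ?_ γ⟩
  · intro p q γ
    obtain ⟨α, hα⟩ := hg₁ p
    obtain ⟨β, hβ⟩ := hg₁ q
    have h := h₁ ((α.trans γ).trans β.symm)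
    rw [PathHom.map_trans, PathHom.map_trans, PathHom.map_symm, ← mul_assoc, ← hα, ← hβ] at h
    exact h
  · intro p q γ
    obtain ⟨α, hα⟩ := hg₂ p
    obtain ⟨β, hβ⟩ := hg₂ q
    have h := h₂ ((α.trans γ).trans β.symm)
    rw [PathHom.map_trans, PathHom.map_trans, PathHom.map_symm, ← mul_assoc, ← hα, ← hβ] at h
    exact h

theorem commute_of_gauge {X : Type*} [TopologicalSpace X] (F : PathHom X G) (g : X → G) {p : X}
    {γ δ : Path p p} (h : Commute ((F.gauge g).toFun γ) ((F.gauge g).toFun δ)) :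
    Commute (F.toFun γ) (F.toFun δ) := by
  have h' : Commute ((g p)⁻¹ * F.toFun γ * g p) ((g p)⁻¹ * F.toFun δ * g p) := h
  rw [← Commute.conj_iff (g p)⁻¹, inv_inv]
  exact h'

/-- After the gauge all values lie in the subgroup generated by the loops of the two pieces, which
is commutative; undoing the gauge only conjugates at `p`. -/
theorem commute_of_commute_pieces [SecondCountableTopology Y₁] [SecondCountableTopology Y₂]
    (hY₁ : HasTorusBoundary Y₁) (hY₂ : HasTorusBoundary Y₂) (F : PathHom (Glue φ) G)
    (x : Bd Y₁)
    (h₁₁ : ∀ γ δ : Path (bdIncl Y₁ x) (bdIncl Y₁ x),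
      Commute ((F.comap (Glue.inl φ)).toFun γ) ((F.comap (Glue.inl φ)).toFun δ))
    (h₁₂ : ∀ (γ : Path (bdIncl Y₁ x) (bdIncl Y₁ x))
      (δ : Path (bdIncl Y₂ (φ x)) (bdIncl Y₂ (φ x))),
      Commute ((F.comap (Glue.inl φ)).toFun γ) ((F.comap (Glue.inr φ)).toFun δ))
    (h₂₂ : ∀ γ δ : Path (bdIncl Y₂ (φ x)) (bdIncl Y₂ (φ x)),
      Commute ((F.comap (Glue.inr φ)).toFun γ) ((F.comap (Glue.inr φ)).toFun δ))
    {p : Glue φ} (γ δ : Path p p) : Commute (F.toFun γ) (F.toFun δ) := by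
  let S : Set G := Set.range (fun γ : Path (bdIncl Y₁ x) (bdIncl Y₁ x) =>
    (F.comap (Glue.inl φ)).toFun γ) ∪
    Set.range fun γ : Path (bdIncl Y₂ (φ x)) (bdIncl Y₂ (φ x)) =>
      (F.comap (Glue.inr φ)).toFun γ
  have hS : ∀ a ∈ S, ∀ b ∈ S, a * b = b * a := by
    rintro _ (⟨γ, rfl⟩ | ⟨γ, rfl⟩) _ (⟨δ, rfl⟩ | ⟨δ, rfl⟩)
    · exact h₁₁ γ δ
    · exact h₁₂ γ δ
    · exact (h₁₂ δ γ).symm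
    · exact h₂₂ γ δ
  obtain ⟨g, hg⟩ := exists_gauge_toFun_mem hY₁ hY₂ F x (Subgroup.closure S)
    (fun γ => Subgroup.subset_closure (Or.inl ⟨γ, rfl⟩))
    (fun γ => Subgroup.subset_closure (Or.inr ⟨γ, rfl⟩))
  refine commute_of_gauge F g ?_
  have := Subgroup.isMulCommutative_closure hS
  exact congr_arg Subtype.val
    (mul_comm' (⟨_, hg _ _ γ⟩ : Subgroup.closure S) ⟨_, hg _ _ δ⟩)

end VanKampen

/-! ### The two implications -/

section Main

variable {Y₁ Y₂ : Type*}
  [TopologicalSpace Y₁] [ChartedSpace (EuclideanHalfSpace 3) Y₁]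
  [TopologicalSpace Y₂] [ChartedSpace (EuclideanHalfSpace 3) Y₂]
  {φ : Bd Y₁ ≃ₜ Bd Y₂}

theorem eq_of_extends {x : Bd Y₁} {η : FundamentalGroup (Bd Y₁) x →* U1}
    {η₂ : FundamentalGroup (Bd Y₂) (φ x) →* U1}
    (hη : η₂.comp (FundamentalGroup.map (φ : C(Bd Y₁, Bd Y₂)) x) = η)
    {ρ₁ : FundamentalGroup Y₁ (bdIncl Y₁ x) →* SU2}
    {ρ₂ : FundamentalGroup Y₂ (bdIncl Y₂ (φ x)) →* SU2}
    (h₁ : Extends x η ρ₁) (h₂ : Extends (φ x) η₂ ρ₂) (ξ : Path x x) :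
    ρ₁ (Path.Homotopic.Quotient.mk (ξ.map (bdIncl Y₁).continuous)) =
      ρ₂ (Path.Homotopic.Quotient.mk ((ξ.map φ.continuous).map (bdIncl Y₂).continuous)) := by
  have e₁ := DFunLike.congr_fun h₁ (Path.Homotopic.Quotient.mk ξ)
  have e₂ := DFunLike.congr_fun h₂ (Path.Homotopic.Quotient.mk (ξ.map φ.continuous))
  have e := congr_arg Subtype.val (DFunLike.congr_fun hη (Path.Homotopic.Quotient.mk ξ))
  exact e₁.trans (e.symm.trans e₂.symm)

variable [T2Space Y₁] [ConnectedSpace Y₁] [T2Space Y₂] [ConnectedSpace Y₂]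

theorem commute_of_isSU2AbelianSpace (hY₁ : HasTorusBoundary Y₁) (hY₂ : HasTorusBoundary Y₂)
    (h : IsSU2AbelianSpace (Glue φ)) (x : Bd Y₁)
    (ρ₁ : FundamentalGroup Y₁ (bdIncl Y₁ x) →* SU2)
    (ρ₂ : FundamentalGroup Y₂ (bdIncl Y₂ (φ x)) →* SU2)
    (hρ : ∀ ξ : Path x x, ρ₁ (Path.Homotopic.Quotient.mk (ξ.map (bdIncl Y₁).continuous)) =
      ρ₂ (Path.Homotopic.Quotient.mk ((ξ.map φ.continuous).map (bdIncl Y₂).continuous))) :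
    IsAbelianRep ρ₁ ∧ IsAbelianRep ρ₂ ∧ ∀ a b, ρ₁ a * ρ₂ b = ρ₂ b * ρ₁ a := by
  obtain ⟨F, hF₁, hF₂⟩ := exists_pathHom_of_homs hY₁ hY₂ x ρ₁ ρ₂ hρ
  have hcomm : ∀ γ δ : Path (Glue.inl φ x) (Glue.inl φ x),
      F.toFun γ * F.toFun δ = F.toFun δ * F.toFun γ := fun γ δ =>
    h _ (F.toHom (Glue.inl φ x)) (Path.Homotopic.Quotient.mk γ) (Path.Homotopic.Quotient.mk δ)
  have e₁ : ∀ a, ∃ γ : Path (Glue.inl φ x) (Glue.inl φ x), ρ₁ a = F.toFun γ := fun a => by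
    induction a using Path.Homotopic.Quotient.ind with
    | _ γ => exact ⟨_, (hF₁ γ).symm⟩
  have e₂ : ∀ b, ∃ γ : Path (Glue.inl φ x) (Glue.inl φ x), ρ₂ b = F.toFun γ := fun b => by
    induction b using Path.Homotopic.Quotient.ind with
    | _ γ =>
      refine ⟨(γ.map (Glue.inr φ).continuous).cast (Glue.inl_boundary φ x)
        (Glue.inl_boundary φ x), ?_⟩
      rw [← hF₂ γ]
      exact F.congr_of_forall_eq _ _ fun t => rfl
  refine ⟨fun a b => ?_, fun a b => ?_, fun a b => ?_⟩
  · obtain ⟨γ, hγ⟩ := e₁ a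
    obtain ⟨δ, hδ⟩ := e₁ b
    rw [hγ, hδ, hcomm]
  · obtain ⟨γ, hγ⟩ := e₂ a
    obtain ⟨δ, hδ⟩ := e₂ b
    rw [hγ, hδ, hcomm]
  · obtain ⟨γ, hγ⟩ := e₁ a
    obtain ⟨δ, hδ⟩ := e₂ b
    rw [hγ, hδ, hcomm]

theorem inter_eq_empty_of_isSU2AbelianSpace (hY₁ : HasTorusBoundary Y₁)
    (hY₂ : HasTorusBoundary Y₂) (h : IsSU2AbelianSpace (Glue φ)) (x : Bd Y₁) :
    setH x ∩ transport φ x (setH (φ x)) = ∅ ∧ setH x ∩ transport φ x (setA (φ x)) = ∅ ∧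
      setA x ∩ transport φ x (setH (φ x)) = ∅ ∧ setP x ∩ transport φ x (setP (φ x)) = ∅ := by
  simp only [Set.eq_empty_iff_forall_notMem]
  refine ⟨?_, ?_, ?_, ?_⟩
  · rintro η ⟨⟨ρ₁, hρ₁, hirr⟩, η₂, ⟨ρ₂, hρ₂, -⟩, hη⟩
    exact hirr (commute_of_isSU2AbelianSpace hY₁ hY₂ h x ρ₁ ρ₂ (eq_of_extends hη hρ₁ hρ₂)).1
  · rintro η ⟨⟨ρ₁, hρ₁, hirr⟩, η₂, ⟨ρ₂, hρ₂, -⟩, hη⟩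
    exact hirr (commute_of_isSU2AbelianSpace hY₁ hY₂ h x ρ₁ ρ₂ (eq_of_extends hη hρ₁ hρ₂)).1
  · rintro η ⟨⟨ρ₁, hρ₁, -⟩, η₂, ⟨ρ₂, hρ₂, hirr⟩, hη⟩
    exact hirr (commute_of_isSU2AbelianSpace hY₁ hY₂ h x ρ₁ ρ₂ (eq_of_extends hη hρ₁ hρ₂)).2.1
  · rintro η ⟨⟨ρ₁, hρ₁, hc, -, hnc₁⟩, η₂, ⟨ρ₂, hρ₂, hc₂, -, hnc₂⟩, hη⟩
    simp only [IsCentralRep, not_forall] at hnc₁ hnc₂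
    obtain ⟨a, ha⟩ := hnc₁
    obtain ⟨b, hb⟩ := hnc₂
    obtain ⟨u, hu⟩ := SU2.exists_conj_not_commute ha hb
    refine hu ?_
    -- Conjugating `ρ₂` leaves its central boundary values unchanged, so it can still be glued to
    -- `ρ₁`.
    have hconj := (commute_of_isSU2AbelianSpace hY₁ hY₂ h x ρ₁
      ((MulAut.conj u⁻¹).toMonoidHom.comp ρ₂) fun ξ => ?_).2.2 a b
    · simpa using hconj
    · rw [eq_of_extends hη hρ₁ hρ₂ ξ]
      have e₂ : ρ₂ (Path.Homotopic.Quotient.mk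
          ((ξ.map φ.continuous).map (bdIncl Y₂).continuous)) ∈ Subgroup.center SU2 := by
        have e := DFunLike.congr_fun hρ₂ (Path.Homotopic.Quotient.mk (ξ.map φ.continuous))
        have e' := hc₂ (Path.Homotopic.Quotient.mk (ξ.map φ.continuous))
        rw [← e] at e'
        exact e'
      have e₃ := Subgroup.mem_center_iff.mp e₂ u⁻¹
      simp only [MonoidHom.comp_apply, MulEquiv.coe_toMonoidHom, MulAut.conj_apply]
      exact eq_mul_inv_of_mul_eq e₃.symm

variable [SecondCountableTopology Y₁] [SecondCountableTopology Y₂]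

theorem commute_of_inter_eq_empty (hY₁ : HasTorusBoundary Y₁) (hY₂ : HasTorusBoundary Y₂)
    (x : Bd Y₁) (hHH : setH x ∩ transport φ x (setH (φ x)) = ∅)
    (hHA : setH x ∩ transport φ x (setA (φ x)) = ∅)
    (hAH : setA x ∩ transport φ x (setH (φ x)) = ∅)
    (hPP : setP x ∩ transport φ x (setP (φ x)) = ∅) (F : PathHom (Glue φ) SU2)
    (hU : ∀ ξ : Path x x, (F.comap ((Glue.inl φ).comp (bdIncl Y₁))).toFun ξ ∈ U1)
    {p : Glue φ} (γ δ : Path p p) : Commute (F.toFun γ) (F.toFun δ) := by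
  let ρ₁ : FundamentalGroup Y₁ (bdIncl Y₁ x) →* SU2 := (F.comap (Glue.inl φ)).toHom _
  let ρ₂ : FundamentalGroup Y₂ (bdIncl Y₂ (φ x)) →* SU2 := (F.comap (Glue.inr φ)).toHom _
  let η : FundamentalGroup (Bd Y₁) x →* U1 :=
    ((F.comap ((Glue.inl φ).comp (bdIncl Y₁))).toHom x).codRestrict U1 fun a => by
      induction a using Path.Homotopic.Quotient.ind with
      | _ ξ => exact hU ξ
  let η₂ : FundamentalGroup (Bd Y₂) (φ x) →* U1 :=
    ((F.comap ((Glue.inr φ).comp (bdIncl Y₂))).toHom (φ x)).codRestrict U1 fun a => by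
      induction a using Path.Homotopic.Quotient.ind with
      | _ ξ =>
        have h := hU ((ξ.map φ.symm.continuous).cast (φ.symm_apply_apply x).symm
          (φ.symm_apply_apply x).symm)
        have e : (F.comap ((Glue.inl φ).comp (bdIncl Y₁))).toFun
            ((ξ.map φ.symm.continuous).cast (φ.symm_apply_apply x).symm
              (φ.symm_apply_apply x).symm) =
            (F.comap ((Glue.inr φ).comp (bdIncl Y₂))).toFun ξ :=
          F.congr_of_forall_eq _ _ fun t => by
            have := Glue.inl_boundary φ (φ.symm (ξ t))
            rw [φ.apply_symm_apply] at this
            exact this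
        rw [e] at h
        exact h
  have hη : η₂.comp (FundamentalGroup.map (φ : C(Bd Y₁, Bd Y₂)) x) = η := by
    ext1 a
    apply Subtype.ext
    induction a using Path.Homotopic.Quotient.ind with
    | _ ξ => exact F.congr_of_forall_eq _ _ fun t => (Glue.inl_boundary φ (ξ t)).symm
  have hρ₁ : Extends x η ρ₁ := by
    ext1 a
    induction a using Path.Homotopic.Quotient.ind with
    | _ ξ => rfl
  have hρ₂ : Extends (φ x) η₂ ρ₂ := by
    ext1 a
    induction a using Path.Homotopic.Quotient.ind with
    | _ ξ => rfl
  have hab₁ : IsAbelianRep ρ₁ := by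
    by_contra h₁
    by_cases h₂ : IsAbelianRep ρ₂
    · exact Set.eq_empty_iff_forall_notMem.mp hHA η ⟨⟨ρ₁, hρ₁, h₁⟩, η₂, ⟨ρ₂, hρ₂, h₂⟩, hη⟩
    · exact Set.eq_empty_iff_forall_notMem.mp hHH η ⟨⟨ρ₁, hρ₁, h₁⟩, η₂, ⟨ρ₂, hρ₂, h₂⟩, hη⟩
  have hab₂ : IsAbelianRep ρ₂ := by
    by_contra h₂
    exact Set.eq_empty_iff_forall_notMem.mp hAH η ⟨⟨ρ₁, hρ₁, hab₁⟩, η₂, ⟨ρ₂, hρ₂, h₂⟩, hη⟩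
  have hcross : ∀ a b, ρ₁ a * ρ₂ b = ρ₂ b * ρ₁ a := by
    -- Central boundary values: by `hPP` one of `ρ₁`, `ρ₂` is central. Otherwise a non-central value
    -- `η a₀` belongs to both abelian images and forces both into `U1`.
    by_cases hc : IsCentralRep (U1.subtype.comp η)
    · by_cases hc₁ : IsCentralRep ρ₁
      · exact fun a b => (Subgroup.mem_center_iff.mp (hc₁ a) _).symm
      by_cases hc₂ : IsCentralRep ρ₂
      · exact fun a b => Subgroup.mem_center_iff.mp (hc₂ b) _
      have hcη₂ : IsCentralRep (U1.subtype.comp η₂) := fun b => by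
        induction b using Path.Homotopic.Quotient.ind with
        | _ ξ =>
          have h := hc (Path.Homotopic.Quotient.mk ((ξ.map φ.symm.continuous).cast
            (φ.symm_apply_apply x).symm (φ.symm_apply_apply x).symm))
          rw [← hη] at h
          have e : ((ξ.map φ.symm.continuous).cast (φ.symm_apply_apply x).symm
              (φ.symm_apply_apply x).symm).map φ.continuous = ξ :=
            Path.ext (funext fun t => φ.apply_symm_apply (ξ t))
          have e' : FundamentalGroup.map (φ : C(Bd Y₁, Bd Y₂)) x
              (Path.Homotopic.Quotient.mk ((ξ.map φ.symm.continuous).cast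
                (φ.symm_apply_apply x).symm (φ.symm_apply_apply x).symm)) =
              Path.Homotopic.Quotient.mk ξ :=
            congr_arg Path.Homotopic.Quotient.mk e
          simp only [MonoidHom.comp_apply] at h ⊢
          rw [e'] at h
          exact h
      exact absurd ⟨⟨ρ₁, hρ₁, hc, hab₁, hc₁⟩, η₂, ⟨ρ₂, hρ₂, hcη₂, hab₂, hc₂⟩, hη⟩
        (Set.eq_empty_iff_forall_notMem.mp hPP η)
    · simp only [IsCentralRep, not_forall] at hc
      obtain ⟨a₀, ha₀⟩ := hc
      have h₁ : ∀ a, ρ₁ a ∈ U1 := fun a => by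
        refine SU2.mem_U1_of_commute (η a₀).2 ha₀ ?_
        have e : ρ₁ (FundamentalGroup.map (bdIncl Y₁) x a₀) = (η a₀ : SU2) :=
          DFunLike.congr_fun hρ₁ a₀
        rw [← e]
        exact hab₁ _ _
      have h₂ : ∀ b, ρ₂ b ∈ U1 := fun b => by
        refine SU2.mem_U1_of_commute (η a₀).2 ha₀ ?_
        have e : ρ₂ (FundamentalGroup.map (bdIncl Y₂) (φ x)
            (FundamentalGroup.map (φ : C(Bd Y₁, Bd Y₂)) x a₀)) = (η a₀ : SU2) := by
          rw [← hη]
          exact DFunLike.congr_fun hρ₂ _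
        rw [← e]
        exact hab₂ _ _
      exact fun a b => SU2.commute_of_mem_U1 (h₁ a) (h₂ b)
  exact commute_of_commute_pieces hY₁ hY₂ F x
    (fun γ δ => hab₁ (Path.Homotopic.Quotient.mk γ) (Path.Homotopic.Quotient.mk δ))
    (fun γ δ => hcross (Path.Homotopic.Quotient.mk γ) (Path.Homotopic.Quotient.mk δ))
    (fun γ δ => hab₂ (Path.Homotopic.Quotient.mk γ) (Path.Homotopic.Quotient.mk δ)) γ δ

theorem isSU2AbelianSpace_of_inter_eq_empty (hY₁ : HasTorusBoundary Y₁)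
    (hY₂ : HasTorusBoundary Y₂)
    (x : Bd Y₁) (hHH : setH x ∩ transport φ x (setH (φ x)) = ∅)
    (hHA : setH x ∩ transport φ x (setA (φ x)) = ∅)
    (hAH : setA x ∩ transport φ x (setH (φ x)) = ∅)
    (hPP : setP x ∩ transport φ x (setP (φ x)) = ∅) : IsSU2AbelianSpace (Glue φ) := by
  intro z ρ a b
  have := pathConnectedSpace_glue (φ := φ) x
  obtain ⟨τ, hτ⟩ := exists_paths_refl (Glue φ) z
  let F := PathHom.ofHom ρ τ
  -- Loops on the torus commute, so a single conjugation, realized as a constant gauge, brings their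
  -- values into `U1`.
  obtain ⟨u, hu⟩ := SU2.exists_conj_mem_U1_of_commute
    (Set.range fun ξ : Path x x => (F.comap ((Glue.inl φ).comp (bdIncl Y₁))).toFun ξ) (by
      rintro _ ⟨γ, rfl⟩ _ ⟨δ, rfl⟩
      exact hY₁.toFun_mul_comm _ γ δ)
  induction a using Path.Homotopic.Quotient.ind with
  | _ γ =>
  induction b using Path.Homotopic.Quotient.ind with
  | _ δ =>
  have h := commute_of_gauge F (fun _ => u) (commute_of_inter_eq_empty hY₁ hY₂ x hHH hHA hAH hPP
    (F.gauge fun _ => u) (fun ξ => hu _ ⟨ξ, rfl⟩) γ δ)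
  rw [PathHom.ofHom_toFun_of_refl ρ hτ, PathHom.ofHom_toFun_of_refl ρ hτ] at h
  exact h

end Main

end SU2Gluing

theorem mainTheorem6
    {Y₁ : Type*} [TopologicalSpace Y₁] [T2Space Y₁] [SecondCountableTopology Y₁]
    [ConnectedSpace Y₁] [ChartedSpace (EuclideanHalfSpace 3) Y₁]
    {Y₂ : Type*} [TopologicalSpace Y₂] [T2Space Y₂] [SecondCountableTopology Y₂]
    [ConnectedSpace Y₂] [ChartedSpace (EuclideanHalfSpace 3) Y₂]
    (hY₁ : SU2Gluing.HasTorusBoundary Y₁) (hY₂ : SU2Gluing.HasTorusBoundary Y₂)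
    (φ : SU2Gluing.Bd Y₁ ≃ₜ SU2Gluing.Bd Y₂) (x : SU2Gluing.Bd Y₁) :
    SU2Gluing.IsSU2AbelianSpace (SU2Gluing.Glue φ) ↔
      SU2Gluing.setH x ∩ SU2Gluing.transport φ x (SU2Gluing.setH (φ x)) = ∅ ∧
      SU2Gluing.setH x ∩ SU2Gluing.transport φ x (SU2Gluing.setA (φ x)) = ∅ ∧
      SU2Gluing.setA x ∩ SU2Gluing.transport φ x (SU2Gluing.setH (φ x)) = ∅ ∧
      SU2Gluing.setP x ∩ SU2Gluing.transport φ x (SU2Gluing.setP (φ x)) = ∅ :=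
  ⟨fun h => SU2Gluing.inter_eq_empty_of_isSU2AbelianSpace hY₁ hY₂ h x,
    fun ⟨hHH, hHA, hAH, hPP⟩ =>
      SU2Gluing.isSU2AbelianSpace_of_inter_eq_empty hY₁ hY₂ x hHH hHA hAH hPP⟩
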